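/- **Setting.** Let $\mathbb A$ be an infinite set of atoms, $\mathcal X$ a set of variables; function symbols are either syntactic ($\mathsf f$) or commutative ($\mathsf f^{\mathsf C}$). Nominal terms are $$s,t ::= a \mid [a]t \mid (t_1,\dots,t_n) \mid \mathsf f\,t \mid \mathsf f^{\mathsf C}(t_0,t_1) \mid \pi\cdot X ,$$ where $\pi$ is a finite permutation of atoms. The action $\pi\cdot t$ is homomorphic, with $\pi\cdot[a]t=[\pi(a)](\pi\cdot t)$ and $\pi\cdot(\pi'\cdot X)=(\pi\circ\pi')\cdot X$. Substitutions $\sigma$ move finitely many variables and satisfy $(\pi\cdot X)\sigma=\pi\cdot(X\sigma)$. Write $\mathrm{supp}(\pi)=\{a\mid \pi(a)\ne a\}$ and $\pi^{\rho}=\rho\pi\rho^{-1}$. A *fixed-point context* $\Upsilon$ is a finite set of primitive constraints $\pi\curlywedge X$; $\mathrm{supp}(\mathrm{perm}(\Upsilon|_X))=\bigcup_{\pi\curlywedge X\in\Upsilon}\mathrm{supp}(\pi)$. **Judgements.** For a finite set $\bar c$ of newly quantified atoms, $\Upsilon\vdash\mathsf N\bar c.\,\pi\curlywedge_{\mathsf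 C}t$ and $\Upsilon\vdash\mathsf N\bar c.\,s\approx_{\mathsf C}t$ are defined inductively by the following rules, in which $c_1$ is any atom not in $\bar c$ and not occurring in the rest of the conclusion. * $\mathsf N\bar c.\,\pi\curlywedge_{\mathsf C}a$ if $\pi(a)=a$; $\ \mathsf N\bar c.\,\pi\curlywedge_{\mathsf C}\pi'\cdot X$ if $\mathrm{supp}(\pi^{\pi'^{-1}})\setminus\bar c\subseteq\mathrm{supp}(\mathrm{perm}(\Upsilon|_X))$; for $\mathsf f\,t$ and tuples, componentwise; $\ \mathsf N\bar c.\,\pi\curlywedge_{\mathsf C}[a]t$ if $\mathsf N\bar c,c_1.\,\pi\curlywedge_{\mathsf C}(a\,c_1)\cdot t$; $\ \mathsf N\bar c.\,\pi\curlywedge_{\mathsf C}\mathsf f^{\mathsf C}(t_0,t_1)$ if $\mathsf N\bar c.\,\pi\cdot\mathsf f^{\mathsf C}(t_0,t_1)\approx_{\mathsf C}\mathsf f^{\mathsf C}(t_0,t_1)$. * $\mathsf N\bar c.\,a\approx_{\mathsf C}a$; $\ \mathsf N\bar c.\,\pi\cdot X\approx_{\mathsf C}\pi'\cdot X$ if $\mathrm{supp}(\pi'^{-1}\circ\pi)\setminus\bar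 c\subseteq\mathrm{supp}(\mathrm{perm}(\Upsilon|_X))$; congruence for $\mathsf f$, for tuples of equal length and for $[a]s\approx_{\mathsf C}[a]t$; $\ \mathsf N\bar c.\,[a]s\approx_{\mathsf C}[b]t$ ($a\neq b$) if $\mathsf N\bar c.\,s\approx_{\mathsf C}(a\,b)\cdot t$ and $\mathsf N\bar c,c_1.\,(a\,c_1)\curlywedge_{\mathsf C}t$; $\ \mathsf N\bar c.\,\mathsf f^{\mathsf C}(s_0,s_1)\approx_{\mathsf C}\mathsf f^{\mathsf C}(t_0,t_1)$ if $\mathsf N\bar c.\,s_0\approx_{\mathsf C}t_i$ and $\mathsf N\bar c.\,s_1\approx_{\mathsf C}t_{1-i}$ for some $i\in\{0,1\}$. **Problems and solutions.** A *$\mathsf C$-unification problem* $Pr$ is a finite set of constraints $\pi\curlywedge^?t$ and $s\approx^?t$. A *solution* of $Pr$ is a pair $\langle\Upsilon,\sigma\rangle$ with $\Upsilon\vdash\pi\curlywedge_{\mathsf C}t\sigma$ for each $\pi\curlywedge^?t\in Pr$, $\Upsilon\vdash s\sigma\approx_{\mathsf C}t\sigma$ for each $s\approx^?t\in Pr$,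 and $\Upsilon\vdash X\sigma\sigma\approx_{\mathsf C}X\sigma$ for each $X\in\mathrm{Var}(Pr)$; $\mathcal U_{\mathsf C}(Pr)$ is the set of solutions. **Ordering.** A pair may come with a finite set $\bar c$ of newly quantified atoms (names newly generated while it was computed), which, being bound by $\mathsf N$, may be renamed. Write $\langle\Upsilon,\sigma\rangle_{\bar c}\preceq\langle\Psi,\delta\rangle$ if, after renaming $\bar c$ in $\langle\Upsilon,\sigma\rangle$ to suitable atoms occurring neither in $\Psi,\delta$ nor among the other atoms of $\langle\Upsilon,\sigma\rangle$, there is a substitution $\rho$, not mentioning $\bar c$, with $$\Psi\vdash\mathsf N\bar c.\,X\sigma\rho\approx_{\mathsf C}X\delta\ \text{ for all } X,\qquad \Psi\vdash\mathsf N\bar c.\,\pi\curlywedge_{\mathsf C}X\rho\ \text{ for all } \pi\curlywedge X\in\Upsilon .$$ A set $\mathcal C$ of pairs with newly quantified atoms not occurring in $Pr$ is a *complete set of solutions* of $Pr$ if $\langle\Upsilon,\sigma\rangle\in\mathcal U_{\mathsf C}(Pr)$ for all $\langle\Upsilon,\sigma\rangle_{\bar c}\in\mathcal C$, and every $\langle\Psi,\delta\rangle\in\mathcal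 U_{\mathsf C}(Pr)$ satisfies $S\preceq\langle\Psi,\delta\rangle$ for some $S\in\mathcal C$. **Simplification.** Fix a generator of new names: given the finite set of names used so far, it supplies two distinct names $c_1,c_2$ outside it. A step $\Longrightarrow$ removes one constraint from the problem, as follows (rules for $\mathsf f$: syntactic $\mathsf f$). * $\pi\curlywedge^?a$, if $\pi(a)=a$: nothing is added. $\ \pi\curlywedge^?\mathsf f\,t$: add $\pi\curlywedge^?t$. $\ \pi\curlywedge^?(t_1,\dots,t_n)$: add all $\pi\curlywedge^?t_i$. $\ \pi\curlywedge^?\mathsf f^{\mathsf C}(t_0,t_1)$: add either $\pi\cdot t_0\approx^?t_0,\ \pi\cdot t_1\approx^?t_1$, or $\pi\cdot t_0\approx^?t_1,\ \pi\cdot t_1\approx^?t_0$. $\ \pi\curlywedge^?[a]t$: add $\pi\curlywedge^?(a\,c_1)\cdot t$ and $(c_1\,c_2)\curlywedge^?X$ for $X\in\mathrm{Var}(t)$. $\ \pi\curlywedge^?\pi'\cdot X$, if $\pi'\ne Id$: add $\pi^{\pi'^{-1}}\curlywedge^?X$. * $a\approx^?a$: nothing is added. $\ \mathsf f\,t\approx^?\mathsf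 f\,t'$: add $t\approx^?t'$. $\ (t_1,\dots,t_n)\approx^?(t'_1,\dots,t'_n)$: add all $t_i\approx^?t'_i$. $\ \mathsf f^{\mathsf C}(t_0,t_1)\approx^?\mathsf f^{\mathsf C}(s_0,s_1)$: add either $t_0\approx^?s_0,\ t_1\approx^?s_1$, or $t_0\approx^?s_1,\ t_1\approx^?s_0$. $\ [a]t\approx^?[a]t'$: add $t\approx^?t'$. $\ [a]t\approx^?[b]s$ ($a\ne b$): add $t\approx^?(a\,b)\cdot s$, $(a\,c_1)\curlywedge^?s$ and $(c_1\,c_2)\curlywedge^?X$ for $X\in\mathrm{Var}(s)$. $\ \pi\cdot X\approx^?\pi'\cdot X$: add $\pi'^{-1}\circ\pi\curlywedge^?X$. * $\pi\cdot X\approx^?t$ or $t\approx^?\pi\cdot X$, if $X\notin\mathrm{Var}(t)$: apply $[X\mapsto\pi^{-1}\cdot t]$ to the remaining problem. The *simplification tree* of $Pr$ consists of everything reachable from $Pr$, and its leaves are the normal forms. A leaf is *successful* if all its constraints have the form $\pi\curlywedge^?X$; the *solution computed* from it is $\langle\Phi,\sigma\rangle_{\bar c}$, where $\Phi=\{\pi\curlywedge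 X\mid\pi\curlywedge^?X\text{ is in the leaf}\}$, $\sigma$ is the composition of the substitutions applied on the way, and $\bar c$ is the set of names generated on the way. **Theorem (Soundness and Completeness of $\mathsf C$-unification).** Let $Pr$ be a $\mathsf C$-unification problem. For every generator of new names: 1. the simplification tree of $Pr$ is finite: there is no infinite sequence of steps starting from $Pr$, and only finitely many nodes are reachable; 2. (soundness) if $\langle\Phi,\sigma\rangle_{\bar c}$ is computed from a successful leaf, then $\langle\Phi,\sigma\rangle\in\mathcal U_{\mathsf C}(Pr)$; 3. (completeness) the set of all solutions computed from the successful leaves is a finite complete set of solutions of $Pr$. Hence nominal $\mathsf C$-unification with fixed-point constraints is finitary: every $\mathsf C$-unification problem has a finite complete set of solutions. -/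

import Mathlib

namespace NomC

universe u v w z

/-! ### Atoms, finite permutations, nominal terms -/

/-- The group of finite permutations of `A`: bijections moving only finitely many atoms. -/
def finPerm (A : Type*) : Subgroup (Equiv.Perm A) where
  carrier := {π | {a | π a ≠ a}.Finite}
  one_mem' := by simp
  mul_mem' := by
    intro π ρ hπ hρ
    refine (hπ.union hρ).subset ?_
    intro a ha
    by_contra h
    simp only [Set.mem_union, Set.mem_ofPred_eq, not_or, not_not] at h
    exact ha (by rw [Equiv.Perm.mul_apply, h.2, h.1])
  inv_mem' := by
    intro π hπ
    refine Set.Finite.subset hπ ?_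
    intro a ha h
    exact ha (by rw [Equiv.Perm.inv_eq_iff_eq]; exact h.symm)

/-- Finite permutations. -/
abbrev FinPerm (A : Type*) := ↥(finPerm A)

/-- The support of a finite permutation: the finite set of atoms that it moves. -/
noncomputable def FinPerm.supp {A : Type*} (π : FinPerm A) : Finset A :=
  Set.Finite.toFinset (s := {a | π.1 a ≠ a}) π.2

/-- The swapping `(a b)`. -/
def FinPerm.swap {A : Type*} [DecidableEq A] (a b : A) : FinPerm A :=
  ⟨Equiv.swap a b, by
    refine Set.Finite.subset (Set.toFinite ({a, b} : Set A)) ?_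
    intro c hc
    by_contra h
    simp only [Set.mem_insert_iff, Set.mem_singleton_iff, not_or] at h
    exact hc (Equiv.swap_apply_of_ne_of_ne h.1 h.2)⟩

/-- Nominal terms over atoms `A`, variables `X`, syntactic function symbols `F` (no equational
theory), and commutative function symbols `C`, the latter being applied to pairs only. -/
inductive NTerm (A X F C : Type*) where
  | atom (a : A)
  | susp (π : FinPerm A) (x : X)
  | abs (a : A) (t : NTerm A X F C)
  | tuple (n : ℕ) (t : Fin n → NTerm A X F C)
  | app (f : F) (t : NTerm A X F C)
  | capp (f : C) (t₀ t₁ : NTerm A X F C)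

namespace NTerm

/-- The action `π · t` of a permutation on a term; it is suspended on variables. -/
def act {A X F C : Type*} (π : FinPerm A) : NTerm A X F C → NTerm A X F C
  | atom a => atom (π.1 a)
  | susp ρ x => susp (π * ρ) x
  | abs a t => abs (π.1 a) (t.act π)
  | tuple n t => tuple n fun i => (t i).act π
  | app f t => app f (t.act π)
  | capp f t₀ t₁ => capp f (t₀.act π) (t₁.act π)

/-- Renaming of the atom occurrences of a term by `τ`, all variables being left untouched:
unlike in `act`, the permutation of a suspension is renamed, that is, conjugated. -/
def rename {A X F C : Type*} (τ : FinPerm A) : NTerm A X F C → NTerm A X F C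
  | atom a => atom (τ.1 a)
  | susp ρ x => susp (τ * ρ * τ⁻¹) x
  | abs a t => abs (τ.1 a) (t.rename τ)
  | tuple n t => tuple n fun i => (t i).rename τ
  | app f t => app f (t.rename τ)
  | capp f t₀ t₁ => capp f (t₀.rename τ) (t₁.rename τ)

/-- The set of variables of a term. -/
def vars {A X F C : Type*} [DecidableEq X] : NTerm A X F C → Finset X
  | atom _ => ∅
  | susp _ x => {x}
  | abs _ t => t.vars
  | tuple _ t => Finset.univ.biUnion fun i => (t i).vars
  | app _ t => t.vars
  | capp _ t₀ t₁ => t₀.vars ∪ t₁.vars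

/-- The set of all atoms that occur in a term (free, abstracted, or in a suspension). -/
noncomputable def atoms {A X F C : Type*} [DecidableEq A] : NTerm A X F C → Finset A
  | atom a => {a}
  | susp π _ => π.supp
  | abs a t => insert a t.atoms
  | tuple _ t => Finset.univ.biUnion fun i => (t i).atoms
  | app _ t => t.atoms
  | capp _ t₀ t₁ => t₀.atoms ∪ t₁.atoms

/-- Replacement of every variable `x` by the term `σ x`, with `(π · x)σ = π · σ(x)`. -/
def bind {A X F C : Type*} (σ : X → NTerm A X F C) : NTerm A X F C → NTerm A X F C
  | atom a => atom a
  | susp π x => (σ x).act π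
  | abs a t => abs a (t.bind σ)
  | tuple n t => tuple n fun i => (t i).bind σ
  | app f t => app f (t.bind σ)
  | capp f t₀ t₁ => capp f (t₀.bind σ) (t₁.bind σ)

end NTerm

/-! ### Substitutions -/

/-- Substitutions: maps from variables to terms that are the identity (`x ↦ Id · x`) on all but
finitely many variables. -/
structure Subst (A X F C : Type*) where
  val : X → NTerm A X F C
  fin : {x | val x ≠ NTerm.susp 1 x}.Finite

/-- Application `tσ` of a substitution to a term. -/
def NTerm.subst {A X F C : Type*} (t : NTerm A X F C) (σ : Subst A X F C) : NTerm A X F C :=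
  t.bind σ.val

theorem NTerm.act_one {A X F C : Type*} (t : NTerm A X F C) : t.act 1 = t := by
  induction t with
  | atom a => simp [NTerm.act]
  | susp ρ x => simp [NTerm.act]
  | abs a t ih => simp [NTerm.act, ih]
  | tuple n t ih => simp [NTerm.act, ih]
  | app f t ih => simp [NTerm.act, ih]
  | capp f t₀ t₁ ih₀ ih₁ => simp [NTerm.act, ih₀, ih₁]

/-- The identity substitution. -/
def Subst.id {A X F C : Type*} : Subst A X F C where
  val x := NTerm.susp 1 x
  fin := by simp

/-- The substitution `[x ↦ u]`. -/
def Subst.single {A X F C : Type*} [DecidableEq X] (x : X) (u : NTerm A X F C) :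
    Subst A X F C where
  val := Function.update (fun y => NTerm.susp 1 y) x u
  fin := by
    refine (Set.finite_singleton x).subset ?_
    intro y hy
    by_contra h
    exact hy (Function.update_of_ne h _ _)

/-- Composition, in diagrammatic order: `t(σ ∘ θ) = (tσ)θ`. -/
def Subst.comp {A X F C : Type*} (σ θ : Subst A X F C) : Subst A X F C where
  val x := (σ.val x).subst θ
  fin := by
    refine (σ.fin.union θ.fin).subset ?_
    intro x hx
    by_contra h
    simp only [Set.mem_union, Set.mem_ofPred_eq, not_or, not_not] at h
    exact hx (by
      show ((σ.val x).bind θ.val) = _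
      rw [h.1]
      show (θ.val x).act 1 = _
      rw [NTerm.act_one, h.2])

/-- The atom `a` occurs in the substitution `σ`. -/
def Subst.Mentions {A X F C : Type*} [DecidableEq A] (σ : Subst A X F C) (a : A) : Prop :=
  ∃ x, a ∈ (σ.val x).atoms

/-! ### Fixed-point contexts and derivable judgements modulo commutativity -/

/-- Fixed-point contexts: finite sets of primitive constraints `π ⋏ X`. -/
abbrev Ctx (A X : Type*) := Finset (FinPerm A × X)

/-- The support of the set of permutations that the context `Υ` attaches to the variable `x`. -/
def Ctx.permSupp {A X : Type*} (Υ : Ctx A X) (x : X) : Set A :=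
  {a | ∃ π : FinPerm A, (π, x) ∈ Υ ∧ π.1 a ≠ a}

/-- The atom `a` occurs in the context `Υ`. -/
def Ctx.Mentions {A X : Type*} (Υ : Ctx A X) (a : A) : Prop :=
  ∃ p ∈ Υ, a ∈ p.1.supp

mutual

/-- `Fixes Υ c π t`: the judgement `Υ ⊢ И c. π ⋏_C t` is derivable, where `c` is the finite set of
newly quantified atoms. -/
inductive Fixes {A : Type u} {X : Type v} {F : Type w} {C : Type z} [DecidableEq A]
    (Υ : Ctx A X) :
    Finset A → FinPerm A → NTerm A X F C → Prop where
  | atom (c : Finset A) (π : FinPerm A) (a : A) : π.1 a = a → Fixes Υ c π (.atom a)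
  | var (c : Finset A) (π ρ : FinPerm A) (x : X) :
      (∀ a ∈ (ρ⁻¹ * π * ρ).supp, a ∉ c → a ∈ Υ.permSupp x) → Fixes Υ c π (.susp ρ x)
  | app (c : Finset A) (π : FinPerm A) (f : F) (t : NTerm A X F C) :
      Fixes Υ c π t → Fixes Υ c π (.app f t)
  | tuple (c : Finset A) (π : FinPerm A) (n : ℕ) (t : Fin n → NTerm A X F C) :
      (∀ i, Fixes Υ c π (t i)) → Fixes Υ c π (.tuple n t)
  | abs (c : Finset A) (π : FinPerm A) (a : A) (t : NTerm A X F C) (c₁ : A) :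
      c₁ ∉ c → ¬ Υ.Mentions c₁ → c₁ ∉ π.supp → c₁ ∉ (NTerm.abs a t).atoms →
      Fixes Υ (insert c₁ c) π (t.act (FinPerm.swap a c₁)) → Fixes Υ c π (.abs a t)
  | capp (c : Finset A) (π : FinPerm A) (f : C) (t₀ t₁ : NTerm A X F C) :
      Equal Υ c ((NTerm.capp f t₀ t₁).act π) (.capp f t₀ t₁) → Fixes Υ c π (.capp f t₀ t₁)

/-- `Equal Υ c s t`: the judgement `Υ ⊢ И c. s ≈_{α,C} t` is derivable. -/
inductive Equal {A : Type u} {X : Type v} {F : Type w} {C : Type z} [DecidableEq A]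
    (Υ : Ctx A X) :
    Finset A → NTerm A X F C → NTerm A X F C → Prop where
  | atom (c : Finset A) (a : A) : Equal Υ c (.atom a) (.atom a)
  | var (c : Finset A) (π ρ : FinPerm A) (x : X) :
      (∀ a ∈ (ρ⁻¹ * π).supp, a ∉ c → a ∈ Υ.permSupp x) → Equal Υ c (.susp π x) (.susp ρ x)
  | app (c : Finset A) (f : F) (s t : NTerm A X F C) :
      Equal Υ c s t → Equal Υ c (.app f s) (.app f t)
  | tuple (c : Finset A) (n : ℕ) (s t : Fin n → NTerm A X F C) :
      (∀ i, Equal Υ c (s i) (t i)) → Equal Υ c (.tuple n s) (.tuple n t)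
  | abs (c : Finset A) (a : A) (s t : NTerm A X F C) :
      Equal Υ c s t → Equal Υ c (.abs a s) (.abs a t)
  | abs_ne (c : Finset A) (a b : A) (s t : NTerm A X F C) (c₁ : A) : a ≠ b →
      c₁ ∉ c → ¬ Υ.Mentions c₁ → c₁ ∉ (NTerm.abs a s).atoms → c₁ ∉ (NTerm.abs b t).atoms →
      Equal Υ c s (t.act (FinPerm.swap a b)) → Fixes Υ (insert c₁ c) (FinPerm.swap a c₁) t →
      Equal Υ c (.abs a s) (.abs b t)
  | capp (c : Finset A) (f : C) (s₀ s₁ t₀ t₁ : NTerm A X F C) :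
      Equal Υ c s₀ t₀ → Equal Υ c s₁ t₁ → Equal Υ c (.capp f s₀ s₁) (.capp f t₀ t₁)
  | capp_swap (c : Finset A) (f : C) (s₀ s₁ t₀ t₁ : NTerm A X F C) :
      Equal Υ c s₀ t₁ → Equal Υ c s₁ t₀ → Equal Υ c (.capp f s₀ s₁) (.capp f t₀ t₁)

end

/-! ### C-unification problems and their solutions -/

/-- Constraints `π ⋏? t` and `s ≈? t`. -/
inductive Constr (A X F C : Type*) where
  | fix (π : FinPerm A) (t : NTerm A X F C)
  | eq (s t : NTerm A X F C)

noncomputable instance Constr.instDecidableEq {A X F C : Type*} : DecidableEq (Constr A X F C) :=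
  Classical.decEq _

def Constr.vars {A X F C : Type*} [DecidableEq X] : Constr A X F C → Finset X
  | fix _ t => t.vars
  | eq s t => s.vars ∪ t.vars

noncomputable def Constr.atoms {A X F C : Type*} [DecidableEq A] : Constr A X F C → Finset A
  | fix π t => π.supp ∪ t.atoms
  | eq s t => s.atoms ∪ t.atoms

def Constr.subst {A X F C : Type*} (σ : Subst A X F C) : Constr A X F C → Constr A X F C
  | fix π t => fix π (t.subst σ)
  | eq s t => eq (s.subst σ) (t.subst σ)

/-- C-unification problems: a finite set of fixed-point constraints together with a finite set of
equality constraints, presented as one finite set of tagged constraints. -/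
abbrev Problem (A X F C : Type*) := Finset (Constr A X F C)

def Problem.vars {A X F C : Type*} [DecidableEq X] (P : Problem A X F C) : Finset X :=
  P.biUnion Constr.vars

noncomputable def Problem.atoms {A X F C : Type*} [DecidableEq A] (P : Problem A X F C) :
    Finset A :=
  P.biUnion Constr.atoms

/-- `⟨Υ, σ⟩` is a solution of the problem `P`. -/
structure IsSolution {A X F C : Type*} [DecidableEq A] [DecidableEq X] (P : Problem A X F C)
    (Υ : Ctx A X) (σ : Subst A X F C) : Prop where
  fix : ∀ π t, Constr.fix π t ∈ P → Fixes Υ ∅ π (t.subst σ)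
  eq : ∀ s t, Constr.eq s t ∈ P → Equal Υ ∅ (s.subst σ) (t.subst σ)
  idem : ∀ x ∈ P.vars, Equal Υ ∅ ((σ.val x).subst σ) (σ.val x)

/-- A pair `⟨Υ, σ⟩` with the finite set `new` of the atoms in it that are newly quantified
(the names that were newly generated while computing it). -/
structure NewSol (A X F C : Type*) where
  new : Finset A
  ctx : Ctx A X
  sub : Subst A X F C

/-- `S ≼ ⟨Ψ, δ⟩`: for some `ρ`, `Ψ ⊢ И c. σρ ≈ δ` and `Ψ ⊢ И c. Υρ`, where `⟨Υ, σ⟩` is the pair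
of `S`, and `c` its newly quantified atoms. As usual for `И`, these are first replaced (by `τ`) by
atoms that are fresh for everything else: for `Ψ`, `δ`, `ρ` and the other atoms of `⟨Υ, σ⟩`.
For `c = ∅` this is the ordering `∃ ρ, Ψ ⊢ σρ ≈ δ and Ψ ⊢ Υρ`. -/
def MoreGeneral {A X F C : Type*} [DecidableEq A] (S : NewSol A X F C)
    (Ψ : Ctx A X) (δ : Subst A X F C) : Prop :=
  ∃ (τ : FinPerm A) (ρ : Subst A X F C),
    (∀ a, S.ctx.Mentions a ∨ S.sub.Mentions a → a ∉ S.new → τ.1 a = a) ∧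
    (∀ a ∈ S.new, ¬ Ψ.Mentions (τ.1 a) ∧ ¬ δ.Mentions (τ.1 a) ∧ ¬ ρ.Mentions (τ.1 a)) ∧
    (∀ x, Equal Ψ (S.new.image τ.1) (((S.sub.val x).rename τ).subst ρ) (δ.val x)) ∧
    (∀ p ∈ S.ctx, Fixes Ψ (S.new.image τ.1) (τ * p.1 * τ⁻¹) (ρ.val p.2))

/-- `Cs` is a complete set of solutions of `P`: its members are solutions of `P` (whose newly
quantified atoms do not occur in `P`), and each solution of `P` is an instance of a member. -/
def IsComplete {A X F C : Type*} [DecidableEq A] [DecidableEq X] (P : Problem A X F C)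
    (Cs : Set (NewSol A X F C)) : Prop :=
  (∀ S ∈ Cs, IsSolution P S.ctx S.sub ∧ Disjoint S.new P.atoms) ∧
  ∀ (Ψ : Ctx A X) (δ : Subst A X F C), IsSolution P Ψ δ → ∃ S ∈ Cs, MoreGeneral S Ψ δ

/-! ### The simplification algorithm -/

/-- A generator of new names: given the finite set of the names used so far, it returns two
different names that are not among them. -/
structure NameGen (A : Type*) where
  gen : Finset A → A × A
  fst_new : ∀ U, (gen U).1 ∉ U
  snd_new : ∀ U, (gen U).2 ∉ U
  ne : ∀ U, (gen U).1 ≠ (gen U).2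

/-- The non-instantiating simplification rules. `Simp c₁ c₂ k D N`: the constraint `k` is replaced
by the constraints in `D`, where `c₁`, `c₂` are the new names on offer and `N` is the set of those
which the rule uses (either none or both). -/
inductive Simp {A X F C : Type*} [DecidableEq A] [DecidableEq X] (c₁ c₂ : A) :
    Constr A X F C → Problem A X F C → Finset A → Prop where
  | fix_atom (π : FinPerm A) (a : A) : π.1 a = a → Simp c₁ c₂ (.fix π (.atom a)) ∅ ∅
  | fix_app (π : FinPerm A) (f : F) (t : NTerm A X F C) :
      Simp c₁ c₂ (.fix π (.app f t)) {.fix π t} ∅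
  | fix_capp_one (π : FinPerm A) (f : C) (t₀ t₁ : NTerm A X F C) :
      Simp c₁ c₂ (.fix π (.capp f t₀ t₁)) {.eq (t₀.act π) t₀, .eq (t₁.act π) t₁} ∅
  | fix_capp_two (π : FinPerm A) (f : C) (t₀ t₁ : NTerm A X F C) :
      Simp c₁ c₂ (.fix π (.capp f t₀ t₁)) {.eq (t₀.act π) t₁, .eq (t₁.act π) t₀} ∅
  | fix_tuple (π : FinPerm A) (n : ℕ) (t : Fin n → NTerm A X F C) :
      Simp c₁ c₂ (.fix π (.tuple n t)) (Finset.univ.image fun i => .fix π (t i)) ∅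
  | fix_abs (π : FinPerm A) (a : A) (t : NTerm A X F C) :
      Simp c₁ c₂ (.fix π (.abs a t))
        (insert (.fix π (t.act (FinPerm.swap a c₁)))
          (t.vars.image fun x => .fix (FinPerm.swap c₁ c₂) (.susp 1 x))) {c₁, c₂}
  | fix_var (π ρ : FinPerm A) (x : X) : ρ ≠ 1 →
      Simp c₁ c₂ (.fix π (.susp ρ x)) {.fix (ρ⁻¹ * π * ρ) (.susp 1 x)} ∅
  | eq_atom (a : A) : Simp c₁ c₂ (.eq (.atom a) (.atom a)) ∅ ∅
  | eq_app (f : F) (s t : NTerm A X F C) : Simp c₁ c₂ (.eq (.app f s) (.app f t)) {.eq s t} ∅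
  | eq_capp_one (f : C) (t₀ t₁ s₀ s₁ : NTerm A X F C) :
      Simp c₁ c₂ (.eq (.capp f t₀ t₁) (.capp f s₀ s₁)) {.eq t₀ s₀, .eq t₁ s₁} ∅
  | eq_capp_two (f : C) (t₀ t₁ s₀ s₁ : NTerm A X F C) :
      Simp c₁ c₂ (.eq (.capp f t₀ t₁) (.capp f s₀ s₁)) {.eq t₀ s₁, .eq t₁ s₀} ∅
  | eq_tuple (n : ℕ) (s t : Fin n → NTerm A X F C) :
      Simp c₁ c₂ (.eq (.tuple n s) (.tuple n t)) (Finset.univ.image fun i => .eq (s i) (t i)) ∅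
  | eq_abs (a : A) (s t : NTerm A X F C) : Simp c₁ c₂ (.eq (.abs a s) (.abs a t)) {.eq s t} ∅
  | eq_abs_ne (a b : A) (t s : NTerm A X F C) : a ≠ b →
      Simp c₁ c₂ (.eq (.abs a t) (.abs b s))
        (insert (.eq t (s.act (FinPerm.swap a b)))
          (insert (.fix (FinPerm.swap a c₁) s)
            (s.vars.image fun x => .fix (FinPerm.swap c₁ c₂) (.susp 1 x)))) {c₁, c₂}
  | eq_var (π ρ : FinPerm A) (x : X) :
      Simp c₁ c₂ (.eq (.susp π x) (.susp ρ x)) {.fix (ρ⁻¹ * π) (.susp 1 x)} ∅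

/-- The instantiating rules. `Inst k x u`: solving the constraint `k` by `[x ↦ u]`. -/
inductive Inst {A X F C : Type*} [DecidableEq X] :
    Constr A X F C → X → NTerm A X F C → Prop where
  | left (π : FinPerm A) (x : X) (t : NTerm A X F C) : x ∉ t.vars →
      Inst (.eq (.susp π x) t) x (t.act π⁻¹)
  | right (π : FinPerm A) (x : X) (t : NTerm A X F C) : x ∉ t.vars →
      Inst (.eq t (.susp π x)) x (t.act π⁻¹)

/-- A node of the simplification tree: the current problem, the composition of the substitutions
applied so far, and the set of the names used so far. -/
structure Node (A X F C : Type*) where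
  prob : Problem A X F C
  sub : Subst A X F C
  used : Finset A

/-- The root of the simplification tree of `P`. -/
noncomputable def Node.root {A X F C : Type*} [DecidableEq A] (P : Problem A X F C) :
    Node A X F C :=
  ⟨P, Subst.id, P.atoms⟩

/-- One simplification step. -/
inductive Step {A X F C : Type*} [DecidableEq A] [DecidableEq X] (g : NameGen A) :
    Node A X F C → Node A X F C → Prop where
  | simp (Q : Problem A X F C) (σ : Subst A X F C) (U : Finset A) (k : Constr A X F C)
      (D : Problem A X F C) (N : Finset A) : k ∉ Q → Simp (g.gen U).1 (g.gen U).2 k D N →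
      Step g ⟨insert k Q, σ, U⟩ ⟨Q ∪ D, σ, U ∪ N⟩
  | inst (Q : Problem A X F C) (σ : Subst A X F C) (U : Finset A) (k : Constr A X F C)
      (x : X) (u : NTerm A X F C) : k ∉ Q → Inst k x u →
      Step g ⟨insert k Q, σ, U⟩
        ⟨Q.image (Constr.subst (Subst.single x u)), σ.comp (Subst.single x u), U⟩

/-- The nodes of the simplification tree of `P`. -/
def tree {A X F C : Type*} [DecidableEq A] [DecidableEq X] (g : NameGen A)
    (P : Problem A X F C) : Set (Node A X F C) :=
  {n | Relation.ReflTransGen (Step g) (Node.root P) n}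

/-- The leaves of the simplification tree of `P`: the normal forms reachable from the root. -/
def leaves {A X F C : Type*} [DecidableEq A] [DecidableEq X] (g : NameGen A)
    (P : Problem A X F C) : Set (Node A X F C) :=
  {n | n ∈ tree g P ∧ ∀ m, ¬ Step g n m}

/-- A problem is successful if it is empty or consists of constraints `π ⋏? X` only. -/
def Problem.Successful {A X F C : Type*} (P : Problem A X F C) : Prop :=
  ∀ k ∈ P, ∃ (π : FinPerm A) (x : X), k = .fix π (.susp 1 x)

open Classical in
/-- The primitive constraint in a constraint `π ⋏? X`. -/
noncomputable def Constr.prim {A X F C : Type*} : Constr A X F C → Ctx A X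
  | .fix π (.susp ρ x) => if ρ = 1 then {(π, x)} else ∅
  | _ => ∅

open Classical in
/-- The fixed-point context `{π ⋏ X | π ⋏? X ∈ P}`. -/
noncomputable def Problem.ctx {A X F C : Type*} (P : Problem A X F C) : Ctx A X :=
  P.biUnion Constr.prim

/-- The solutions computed from the successful leaves of the simplification tree of `P`: the
fixed-point context of the leaf with the composition of the substitutions applied on the way, the
newly quantified atoms being the names generated on the way. -/
def computed {A X F C : Type*} [DecidableEq A] [DecidableEq X] (g : NameGen A)
    (P : Problem A X F C) : Set (NewSol A X F C) :=
  {S | ∃ n ∈ leaves g P, n.prob.Successful ∧ S = ⟨n.used \ P.atoms, n.prob.ctx, n.sub⟩}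

end NomC

/-!
Why the theorem holds. Both judgements are first given a meaning that involves no choice of new
atoms. `EnvEq D e₁ e₂ s t` compares two terms whose atoms are read by environments `e₁` and `e₂`; a
binder extends the environments by one new value, as in a de Bruijn representation, and `D x` is the
set of atoms that are fresh for `x`. This is visibly an equivalence, and permutations acting on
terms are absorbed into the environments (`EnvEq.act_left_iff`). For `D x = permSupp Υ x ∪ c`
derivability of `И c. s ≈ t` and `И c. π ⋏ t` is the same as `EnvEq` of `s` and `t` read by the
identity, and of `t` with itself read by `π` and by the identity (`equal_iff`, `fixes_iff`).

Termination: an instantiating step eliminates a variable, any other step introduces no variable and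
replaces a constraint by constraints of smaller total weight (`Step.measure_lt`). As each node has
finitely many children, the tree is finite (`finite_reachable`).

Soundness: satisfaction of the constraints travels from a child to its parent (`Simp.sat`,
`exists_sat_of_reachable`), and a successful leaf is satisfied by its own context. The delicate
rules are those that generate `c₁` and `c₂`: modulo commutativity the constraint `(c₁ c₂) ⋏ X` does
not make `c₁` and `c₂` fresh for `X`, since a swapping may exchange the arguments of a commutative
symbol. It is nevertheless enough: a permutation of order three that fixes a term moves none of its
free atoms, because the automorphisms of a term that come from commutativity form a 2-group
(`EnvEq.apply_eq_of_order_three`), and a second swapping that overlaps with `(c₁ c₂)` is available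
whenever freshness is needed (`EnvEq.abs_of_swaps`).

Completeness: given a solution `⟨Ψ, δ⟩`, the generated names are renamed apart from it by a
permutation `τ`, and `δ` itself serves as the substitution `ρ`. Reading the tree with the values
`τ⁻¹ · δ(x)`, in which the generated names are fresh, each satisfied node that is not successful has
a satisfied child (`Constr.Sat.exists_simp_or_inst`, `Node.Solvable.exists_step`): rules for
commutative symbols are chosen by the derivation at hand, and the occurs check succeeds since equal
terms have equal sizes. By termination a successful leaf is reached (`exists_moreGeneral`).
-/

namespace NomC

universe u

section

variable {A : Type u} {X F C : Type*}

/-! ### Equality of terms relative to environments -/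

/-- The environment under a binder of `a`: the bound atom denotes the new value `none`. -/
def extend {V : Type u} [DecidableEq A] (e : A → V) (a : A) : A → Option V :=
  Function.update (fun x => some (e x)) a none

/-- `EnvEq D e₁ e₂ s t`: the term `s`, its atoms being read by `e₁`, and the term `t`, its atoms
being read by `e₂`, are equal modulo α and commutativity, when the atoms of `D x` are fresh for the
variable `x`. Binders extend the environments, so that no atom is ever renamed. -/
inductive EnvEq [DecidableEq A] (D : X → Set A) :
    ∀ {V : Type u}, (A → V) → (A → V) → NTerm A X F C → NTerm A X F C → Prop where
  | atom {V : Type u} (e₁ e₂ : A → V) (a b : A) : e₁ a = e₂ b → EnvEq D e₁ e₂ (.atom a) (.atom b)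
  | susp {V : Type u} (e₁ e₂ : A → V) (π ρ : FinPerm A) (x : X) :
      (∀ a, a ∉ D x → e₁ (π.1 a) = e₂ (ρ.1 a)) → EnvEq D e₁ e₂ (.susp π x) (.susp ρ x)
  | abs {V : Type u} (e₁ e₂ : A → V) (a b : A) (s t : NTerm A X F C) :
      EnvEq D (extend e₁ a) (extend e₂ b) s t → EnvEq D e₁ e₂ (.abs a s) (.abs b t)
  | tuple {V : Type u} (e₁ e₂ : A → V) (n : ℕ) (s t : Fin n → NTerm A X F C) :
      (∀ i, EnvEq D e₁ e₂ (s i) (t i)) → EnvEq D e₁ e₂ (.tuple n s) (.tuple n t)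
  | app {V : Type u} (e₁ e₂ : A → V) (f : F) (s t : NTerm A X F C) :
      EnvEq D e₁ e₂ s t → EnvEq D e₁ e₂ (.app f s) (.app f t)
  | capp {V : Type u} (e₁ e₂ : A → V) (f : C) (s₀ s₁ t₀ t₁ : NTerm A X F C) :
      EnvEq D e₁ e₂ s₀ t₀ → EnvEq D e₁ e₂ s₁ t₁ → EnvEq D e₁ e₂ (.capp f s₀ s₁) (.capp f t₀ t₁)
  | capp_swap {V : Type u} (e₁ e₂ : A → V) (f : C) (s₀ s₁ t₀ t₁ : NTerm A X F C) :
      EnvEq D e₁ e₂ s₀ t₁ → EnvEq D e₁ e₂ s₁ t₀ → EnvEq D e₁ e₂ (.capp f s₀ s₁) (.capp f t₀ t₁)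

/-- The free atoms of a term, when the atoms of `D x` are fresh for the variable `x`. -/
def free (D : X → Set A) : NTerm A X F C → Set A
  | .atom a => {a}
  | .susp π x => {a | (π⁻¹).1 a ∉ D x}
  | .abs a t => free D t \ {a}
  | .tuple _ t => ⋃ i, free D (t i)
  | .app _ t => free D t
  | .capp _ t₀ t₁ => free D t₀ ∪ free D t₁

section Extend

variable [DecidableEq A] {V W : Type u}

@[simp] theorem extend_self (e : A → V) (a : A) : extend e a a = none := by simp [extend]

theorem extend_of_ne (e : A → V) {a b : A} (h : b ≠ a) : extend e a b = some (e b) := by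
  simp [extend, h]

theorem extend_comp (j : V → W) (e : A → V) (a : A) :
    extend (j ∘ e) a = Option.map j ∘ extend e a := by
  funext b
  by_cases h : b = a
  · subst h; simp
  · simp [extend_of_ne _ h]

theorem extend_comp_perm (e : A → V) (π : FinPerm A) (a : A) :
    extend e (π.1 a) ∘ π.1 = extend (e ∘ π.1) a := by
  funext b
  by_cases h : b = a
  · subst h; simp
  · have : π.1 b ≠ π.1 a := fun h' => h (π.1.injective h')
    simp [extend_of_ne _ h, extend_of_ne _ this]

theorem extend_injective {e : A → V} (he : Function.Injective e) (a : A) :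
    Function.Injective (extend e a) := by
  intro b c h
  by_cases hb : b = a <;> by_cases hc : c = a
  · rw [hb, hc]
  · subst hb; simp [extend_of_ne _ hc] at h
  · subst hc; simp [extend_of_ne _ hb] at h
  · rw [extend_of_ne _ hb, extend_of_ne _ hc] at h
    exact he (Option.some.inj h)

end Extend

/-! ### Free atoms -/

theorem mem_free_act (D : X → Set A) (π : FinPerm A) (t : NTerm A X F C) (a : A) :
    a ∈ free D (t.act π) ↔ (π⁻¹).1 a ∈ free D t := by
  induction t with
  | atom b => simp [NTerm.act, free, Equiv.symm_apply_eq]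
  | susp ρ x => simp [NTerm.act, free]
  | abs b t ih => simp [NTerm.act, free, ih, Equiv.symm_apply_eq]
  | tuple n t ih => simp [NTerm.act, free, ih]
  | app f t ih => simpa [NTerm.act, free] using ih
  | capp f t₀ t₁ ih₀ ih₁ => simp [NTerm.act, free, ih₀, ih₁]

theorem mem_supp {π : FinPerm A} {a : A} : a ∈ π.supp ↔ π.1 a ≠ a :=
  Set.Finite.mem_toFinset (s := {a | π.1 a ≠ a}) π.2

theorem inv_apply_eq {π : FinPerm A} {a : A} (h : π.1 a = a) : (π⁻¹).1 a = a := by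
  simp only [InvMemClass.coe_inv, Equiv.Perm.inv_eq_iff_eq]; exact h.symm

theorem not_mem_free_bind [DecidableEq A] [DecidableEq X] (D : X → Set A)
    (δ : X → NTerm A X F C) {c : A} (t : NTerm A X F C)
    (hc : c ∉ t.atoms) (h : ∀ x ∈ t.vars, c ∉ free D (δ x)) : c ∉ free D (t.bind δ) := by
  induction t with
  | atom b => simpa [NTerm.bind, free, NTerm.atoms] using hc
  | susp ρ x =>
    have h1 : ρ.1 c = c := by simpa [NTerm.atoms, mem_supp] using hc
    simp only [NTerm.bind, mem_free_act, inv_apply_eq h1]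
    exact h x (by simp [NTerm.vars])
  | abs b t ih =>
    simp only [NTerm.atoms, Finset.mem_insert, not_or] at hc
    exact fun h' => ih hc.2 h h'.1
  | tuple n t ih =>
    simp only [NTerm.atoms, Finset.mem_biUnion, Finset.mem_univ, true_and, not_exists] at hc
    simp only [NTerm.bind, free, Set.mem_iUnion, not_exists]
    exact fun i => ih i (hc i) fun x hx => h x (by
      simp only [NTerm.vars, Finset.mem_biUnion, Finset.mem_univ, true_and]; exact ⟨i, hx⟩)
  | app f t ih => exact ih hc h
  | capp f t₀ t₁ ih₀ ih₁ =>
    simp only [NTerm.atoms, Finset.mem_union, not_or] at hc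
    simp only [NTerm.bind, free, Set.mem_union, not_or]
    exact ⟨ih₀ hc.1 fun x hx => h x (by simp [NTerm.vars, hx]),
      ih₁ hc.2 fun x hx => h x (by simp [NTerm.vars, hx])⟩

/-- An atom that does not occur in a term and is fresh for all variables is not free in it. -/
theorem not_mem_free [DecidableEq A] (D : X → Set A) {c : A} (hD : ∀ x, c ∈ D x)
    (t : NTerm A X F C) (hc : c ∉ t.atoms) : c ∉ free D t := by
  induction t with
  | atom b => simpa [free, NTerm.atoms] using hc
  | susp ρ x =>
    have h1 : ρ.1 c = c := by simpa [NTerm.atoms, mem_supp] using hc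
    simp only [free, Set.mem_ofPred_eq, inv_apply_eq h1, not_not]
    exact hD x
  | abs b t ih =>
    simp only [NTerm.atoms, Finset.mem_insert, not_or] at hc
    exact fun h' => ih hc.2 h'.1
  | tuple n t ih =>
    simp only [NTerm.atoms, Finset.mem_biUnion, Finset.mem_univ, true_and, not_exists] at hc
    simp only [free, Set.mem_iUnion, not_exists]
    exact fun i => ih i (hc i)
  | app f t ih => exact ih hc
  | capp f t₀ t₁ ih₀ ih₁ =>
    simp only [NTerm.atoms, Finset.mem_union, not_or] at hc
    simp only [free, Set.mem_union, not_or]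
    exact ⟨ih₀ hc.1, ih₁ hc.2⟩

/-- Enlarging the fresh sets by one atom `c` removes at most `c` from the free atoms of a term in
which `c` does not occur. -/
theorem free_subset_insert [DecidableEq A] {D D' : X → Set A} {c : A}
    (hD : ∀ x, D' x ⊆ insert c (D x)) (t : NTerm A X F C) (hc : c ∉ t.atoms) {a : A} (hac : a ≠ c)
    (ha : a ∈ free D t) : a ∈ free D' t := by
  induction t with
  | atom b => exact ha
  | susp ρ x =>
    have h1 : ρ.1 c = c := by simpa [NTerm.atoms, mem_supp] using hc
    intro h2
    rcases hD x h2 with h3 | h3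
    · exact hac (by rw [← h1, ← h3]; simp)
    · exact ha h3
  | abs b t ih =>
    simp only [NTerm.atoms, Finset.mem_insert, not_or] at hc
    exact ⟨ih hc.2 ha.1, ha.2⟩
  | tuple n t ih =>
    simp only [NTerm.atoms, Finset.mem_biUnion, Finset.mem_univ, true_and, not_exists] at hc
    simp only [free, Set.mem_iUnion] at ha ⊢
    obtain ⟨i, hi⟩ := ha
    exact ⟨i, ih i (hc i) hi⟩
  | app f t ih => exact ih hc ha
  | capp f t₀ t₁ ih₀ ih₁ =>
    simp only [NTerm.atoms, Finset.mem_union, not_or] at hc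
    exact ha.imp (ih₀ hc.1) (ih₁ hc.2)

namespace EnvEq

variable [DecidableEq A] {V W : Type u} {D D' : X → Set A} {e₁ e₂ e₃ : A → V}
  {s t r : NTerm A X F C}

/-! ### Basic properties of equality relative to environments -/

theorem abs_iff {a b : A} :
    EnvEq D e₁ e₂ (.abs a s) (.abs b t) ↔ EnvEq D (extend e₁ a) (extend e₂ b) s t :=
  ⟨fun h => by cases h; assumption, fun h => .abs _ _ _ _ _ _ h⟩

theorem app_iff {f : F} :
    EnvEq D e₁ e₂ (.app f s) (.app f t) ↔ EnvEq D e₁ e₂ s t :=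
  ⟨fun h => by cases h; assumption, fun h => .app _ _ _ _ _ h⟩

theorem tuple_iff {n : ℕ} {s t : Fin n → NTerm A X F C} :
    EnvEq D e₁ e₂ (.tuple n s) (.tuple n t) ↔ ∀ i, EnvEq D e₁ e₂ (s i) (t i) :=
  ⟨fun h => by cases h; assumption, fun h => .tuple _ _ _ _ _ h⟩

theorem capp_iff {f : C} {s₀ s₁ t₀ t₁ : NTerm A X F C} :
    EnvEq D e₁ e₂ (.capp f s₀ s₁) (.capp f t₀ t₁) ↔
      EnvEq D e₁ e₂ s₀ t₀ ∧ EnvEq D e₁ e₂ s₁ t₁ ∨ EnvEq D e₁ e₂ s₀ t₁ ∧ EnvEq D e₁ e₂ s₁ t₀ := by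
  constructor
  · intro h
    cases h with
    | capp _ _ _ _ _ _ _ h₀ h₁ => exact .inl ⟨h₀, h₁⟩
    | capp_swap _ _ _ _ _ _ _ h₀ h₁ => exact .inr ⟨h₀, h₁⟩
  · rintro (⟨h₀, h₁⟩ | ⟨h₀, h₁⟩)
    · exact .capp _ _ _ _ _ _ _ h₀ h₁
    · exact .capp_swap _ _ _ _ _ _ _ h₀ h₁

theorem mono (hD : ∀ x, D x ⊆ D' x) (h : EnvEq D e₁ e₂ s t) : EnvEq D' e₁ e₂ s t := by
  induction h with
  | atom e₁ e₂ a b h => exact .atom _ _ _ _ h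
  | susp e₁ e₂ π ρ x h => exact .susp _ _ _ _ _ fun a ha => h a fun h' => ha (hD x h')
  | abs _ _ _ _ _ _ _ ih => exact .abs _ _ _ _ _ _ ih
  | tuple _ _ _ _ _ _ ih => exact .tuple _ _ _ _ _ ih
  | app _ _ _ _ _ _ ih => exact .app _ _ _ _ _ ih
  | capp _ _ _ _ _ _ _ _ _ ih₀ ih₁ => exact .capp _ _ _ _ _ _ _ ih₀ ih₁
  | capp_swap _ _ _ _ _ _ _ _ _ ih₀ ih₁ => exact .capp_swap _ _ _ _ _ _ _ ih₀ ih₁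

/-- Only the free atoms of a term matter to its reading. -/
theorem of_agree (t : NTerm A X F C) (h : ∀ a ∈ free D t, e₁ a = e₂ a) : EnvEq D e₁ e₂ t t := by
  induction t generalizing V with
  | atom a => exact .atom _ _ _ _ (h a rfl)
  | susp π x => exact .susp _ _ _ _ _ fun a ha => h _ (by simpa [free] using ha)
  | abs b t ih =>
    refine .abs _ _ _ _ _ _ (ih fun a ha => ?_)
    by_cases hab : a = b
    · subst hab; simp
    · rw [extend_of_ne _ hab, extend_of_ne _ hab, h a ⟨ha, hab⟩]
  | tuple n t ih =>
    exact .tuple _ _ _ _ _ fun i => ih i fun a ha => h a (Set.mem_iUnion.2 ⟨i, ha⟩)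
  | app f t ih => exact .app _ _ _ _ _ (ih h)
  | capp f t₀ t₁ ih₀ ih₁ =>
    exact .capp _ _ _ _ _ _ _ (ih₀ fun a ha => h a (.inl ha)) (ih₁ fun a ha => h a (.inr ha))

theorem refl (e : A → V) (t : NTerm A X F C) : EnvEq D e e t t := of_agree t fun _ _ => rfl

theorem symm (h : EnvEq D e₁ e₂ s t) : EnvEq D e₂ e₁ t s := by
  induction h with
  | atom e₁ e₂ a b h => exact .atom _ _ _ _ h.symm
  | susp e₁ e₂ π ρ x h => exact .susp _ _ _ _ _ fun a ha => (h a ha).symm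
  | abs _ _ _ _ _ _ _ ih => exact .abs _ _ _ _ _ _ ih
  | tuple _ _ _ _ _ _ ih => exact .tuple _ _ _ _ _ ih
  | app _ _ _ _ _ _ ih => exact .app _ _ _ _ _ ih
  | capp _ _ _ _ _ _ _ _ _ ih₀ ih₁ => exact .capp _ _ _ _ _ _ _ ih₀ ih₁
  | capp_swap _ _ _ _ _ _ _ _ _ ih₀ ih₁ => exact .capp_swap _ _ _ _ _ _ _ ih₁ ih₀

theorem trans (h : EnvEq D e₁ e₂ s t) (h' : EnvEq D e₂ e₃ t r) : EnvEq D e₁ e₃ s r := by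
  induction h generalizing r with
  | atom e₁ e₂ a b h => cases h' with | atom _ _ _ _ h' => exact .atom _ _ _ _ (h.trans h')
  | susp e₁ e₂ π ρ x h =>
    cases h' with
    | susp _ _ _ _ _ h' => exact .susp _ _ _ _ _ fun a ha => (h a ha).trans (h' a ha)
  | abs _ _ _ _ _ _ _ ih => cases h' with | abs _ _ _ _ _ _ h' => exact .abs _ _ _ _ _ _ (ih h')
  | tuple _ _ _ _ _ _ ih =>
    cases h' with | tuple _ _ _ _ _ h' => exact .tuple _ _ _ _ _ fun i => ih i (h' i)
  | app _ _ _ _ _ _ ih => cases h' with | app _ _ _ _ _ h' => exact .app _ _ _ _ _ (ih h')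
  | capp _ _ _ _ _ _ _ _ _ ih₀ ih₁ =>
    cases h' with
    | capp _ _ _ _ _ _ _ h₀ h₁ => exact .capp _ _ _ _ _ _ _ (ih₀ h₀) (ih₁ h₁)
    | capp_swap _ _ _ _ _ _ _ h₀ h₁ => exact .capp_swap _ _ _ _ _ _ _ (ih₀ h₀) (ih₁ h₁)
  | capp_swap _ _ _ _ _ _ _ _ _ ih₀ ih₁ =>
    cases h' with
    | capp _ _ _ _ _ _ _ h₀ h₁ => exact .capp_swap _ _ _ _ _ _ _ (ih₀ h₁) (ih₁ h₀)
    | capp_swap _ _ _ _ _ _ _ h₀ h₁ => exact .capp _ _ _ _ _ _ _ (ih₀ h₁) (ih₁ h₀)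

theorem map (j : V → W) (h : EnvEq D e₁ e₂ s t) : EnvEq D (j ∘ e₁) (j ∘ e₂) s t := by
  induction h generalizing W with
  | atom e₁ e₂ a b h => exact .atom _ _ _ _ (congrArg j h)
  | susp e₁ e₂ π ρ x h => exact .susp _ _ _ _ _ fun a ha => congrArg j (h a ha)
  | abs _ _ _ _ _ _ _ ih =>
    refine .abs _ _ _ _ _ _ ?_
    rw [extend_comp, extend_comp]
    exact ih _
  | tuple _ _ _ _ _ _ ih => exact .tuple _ _ _ _ _ fun i => ih i j
  | app _ _ _ _ _ _ ih => exact .app _ _ _ _ _ (ih j)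
  | capp _ _ _ _ _ _ _ _ _ ih₀ ih₁ => exact .capp _ _ _ _ _ _ _ (ih₀ j) (ih₁ j)
  | capp_swap _ _ _ _ _ _ _ _ _ ih₀ ih₁ => exact .capp_swap _ _ _ _ _ _ _ (ih₀ j) (ih₁ j)

theorem map_iff [Nonempty V] {j : V → W} (hj : Function.Injective j) :
    EnvEq D (j ∘ e₁) (j ∘ e₂) s t ↔ EnvEq D e₁ e₂ s t := by
  refine ⟨fun h => ?_, map j⟩
  obtain ⟨g, hg⟩ := hj.hasLeftInverse
  have := h.map g
  rwa [← Function.comp_assoc, ← Function.comp_assoc, hg.comp_eq_id] at this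

/-- The action of a permutation on a term can be absorbed into the environment. -/
theorem act_left_iff (π : FinPerm A) :
    EnvEq D e₁ e₂ (s.act π) t ↔ EnvEq D (e₁ ∘ π.1) e₂ s t := by
  constructor
  · intro h
    generalize hs : s.act π = s' at h
    induction h generalizing s with
    | atom e₁ e₂ a b h => cases s <;> cases hs; exact .atom _ _ _ _ h
    | susp e₁ e₂ π' ρ x h => cases s <;> cases hs; exact .susp _ _ _ _ _ h
    | abs _ _ _ _ _ _ _ ih =>
      cases s <;> cases hs
      refine .abs _ _ _ _ _ _ ?_
      rw [← extend_comp_perm]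
      exact ih rfl
    | tuple _ _ _ _ _ _ ih => cases s <;> cases hs; exact .tuple _ _ _ _ _ fun i => ih i rfl
    | app _ _ _ _ _ _ ih => cases s <;> cases hs; exact .app _ _ _ _ _ (ih rfl)
    | capp _ _ _ _ _ _ _ _ _ ih₀ ih₁ =>
      cases s <;> cases hs; exact .capp _ _ _ _ _ _ _ (ih₀ rfl) (ih₁ rfl)
    | capp_swap _ _ _ _ _ _ _ _ _ ih₀ ih₁ =>
      cases s <;> cases hs; exact .capp_swap _ _ _ _ _ _ _ (ih₀ rfl) (ih₁ rfl)
  · intro h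
    generalize he : e₁ ∘ π.1 = e at h
    induction h with
    | atom e e₂ a b h => subst he; exact .atom _ _ _ _ h
    | susp e e₂ π' ρ x h => subst he; exact .susp _ _ _ _ _ h
    | abs _ _ _ _ _ _ _ ih =>
      subst he
      exact .abs _ _ _ _ _ _ (ih (extend_comp_perm _ _ _))
    | tuple _ _ _ _ _ _ ih => exact .tuple _ _ _ _ _ fun i => ih i he
    | app _ _ _ _ _ _ ih => exact .app _ _ _ _ _ (ih he)
    | capp _ _ _ _ _ _ _ _ _ ih₀ ih₁ => exact .capp _ _ _ _ _ _ _ (ih₀ he) (ih₁ he)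
    | capp_swap _ _ _ _ _ _ _ _ _ ih₀ ih₁ => exact .capp_swap _ _ _ _ _ _ _ (ih₀ he) (ih₁ he)

theorem act_right_iff (π : FinPerm A) :
    EnvEq D e₁ e₂ s (t.act π) ↔ EnvEq D e₁ (e₂ ∘ π.1) s t :=
  ⟨fun h => ((act_left_iff π).1 h.symm).symm, fun h => ((act_left_iff π).2 h.symm).symm⟩

/-- Equal terms have the same free atoms, up to the reading of atoms. -/
theorem exists_free (h : EnvEq D e₁ e₂ s t) {a : A} (ha : a ∈ free D s) :
    ∃ b ∈ free D t, e₁ a = e₂ b := by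
  induction h generalizing a with
  | atom e₁ e₂ a' b h => cases ha; exact ⟨b, rfl, h⟩
  | susp e₁ e₂ π ρ x h =>
    refine ⟨ρ.1 ((π⁻¹).1 a), by simpa [free] using ha, ?_⟩
    rw [← h _ ha]; simp
  | abs e₁ e₂ a' b' _ _ _ ih =>
    obtain ⟨b, hb, hab⟩ := ih ha.1
    rw [extend_of_ne _ ha.2] at hab
    have hb' : b ≠ b' := by rintro rfl; simp at hab
    rw [extend_of_ne _ hb'] at hab
    exact ⟨b, ⟨hb, hb'⟩, Option.some.inj hab⟩
  | tuple _ _ _ _ _ _ ih =>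
    obtain ⟨i, hi⟩ := Set.mem_iUnion.1 ha
    obtain ⟨b, hb, h⟩ := ih i hi
    exact ⟨b, Set.mem_iUnion.2 ⟨i, hb⟩, h⟩
  | app _ _ _ _ _ _ ih => exact ih ha
  | capp _ _ _ _ _ _ _ _ _ ih₀ ih₁ =>
    rcases ha with ha | ha
    · obtain ⟨b, hb, h⟩ := ih₀ ha; exact ⟨b, .inl hb, h⟩
    · obtain ⟨b, hb, h⟩ := ih₁ ha; exact ⟨b, .inr hb, h⟩
  | capp_swap _ _ _ _ _ _ _ _ _ ih₀ ih₁ =>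
    rcases ha with ha | ha
    · obtain ⟨b, hb, h⟩ := ih₀ ha; exact ⟨b, .inr hb, h⟩
    · obtain ⟨b, hb, h⟩ := ih₁ ha; exact ⟨b, .inl hb, h⟩

/-- An atom that is fresh for all variables, does not occur in the terms and is read alike on both
sides is not needed in the fresh sets. -/
theorem of_insert {c : A} (hD : ∀ x, D' x ⊆ insert c (D x)) (hs : c ∉ s.atoms) (ht : c ∉ t.atoms)
    (hc : e₁ c = e₂ c) (h : EnvEq D' e₁ e₂ s t) : EnvEq D e₁ e₂ s t := by
  induction h with
  | atom e₁ e₂ a b h => exact .atom _ _ _ _ h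
  | susp e₁ e₂ π ρ x h =>
    refine .susp _ _ _ _ _ fun a ha => ?_
    by_cases h' : a ∈ D' x
    · obtain rfl | h' := hD x h'
      · have h1 : π.1 a = a := by simpa [NTerm.atoms, mem_supp] using hs
        have h2 : ρ.1 a = a := by simpa [NTerm.atoms, mem_supp] using ht
        rw [h1, h2, hc]
      · exact absurd h' ha
    · exact h a h'
  | abs e₁ e₂ a b _ _ _ ih =>
    simp only [NTerm.atoms, Finset.mem_insert, not_or] at hs ht
    exact .abs _ _ _ _ _ _ (ih hs.2 ht.2 (by rw [extend_of_ne _ hs.1, extend_of_ne _ ht.1, hc]))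
  | tuple _ _ _ _ _ _ ih =>
    simp only [NTerm.atoms, Finset.mem_biUnion, Finset.mem_univ, true_and, not_exists] at hs ht
    exact .tuple _ _ _ _ _ fun i => ih i (hs i) (ht i) hc
  | app _ _ _ _ _ _ ih => exact .app _ _ _ _ _ (ih hs ht hc)
  | capp _ _ _ _ _ _ _ _ _ ih₀ ih₁ =>
    simp only [NTerm.atoms, Finset.mem_union, not_or] at hs ht
    exact .capp _ _ _ _ _ _ _ (ih₀ hs.1 ht.1 hc) (ih₁ hs.2 ht.2 hc)
  | capp_swap _ _ _ _ _ _ _ _ _ ih₀ ih₁ =>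
    simp only [NTerm.atoms, Finset.mem_union, not_or] at hs ht
    exact .capp_swap _ _ _ _ _ _ _ (ih₀ hs.1 ht.2 hc) (ih₁ hs.2 ht.1 hc)

/-! ### Permutations fixing a term -/

/-- A permutation of order three that fixes a term modulo commutativity moves no free atom of it:
commutativity exchanges two arguments, and the cube of an exchange is an exchange. -/
theorem apply_eq_of_order_three (t : NTerm A X F C) (e : A → V) (φ : V → V)
    (hφ : φ ∘ φ ∘ φ = id) (h : EnvEq D (φ ∘ e) e t t) {a : A} (ha : a ∈ free D t) :
    φ (e a) = e a := by
  induction t generalizing V a with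
  | atom b => cases ha; cases h; assumption
  | susp π x =>
    cases h with
    | susp _ _ _ _ _ h => simpa using h _ ha
  | abs b t ih =>
    rw [abs_iff, extend_comp] at h
    have h3 : Option.map φ ∘ Option.map φ ∘ Option.map φ = id := by
      rw [Option.map_comp_map, Option.map_comp_map, hφ, Option.map_id]
    have := ih _ _ h3 h ha.1
    rw [extend_of_ne _ ha.2] at this
    exact Option.some.inj this
  | tuple n t ih =>
    obtain ⟨i, hi⟩ := Set.mem_iUnion.1 ha
    exact ih i _ _ hφ (tuple_iff.1 h i) hi
  | app f t ih => exact ih _ _ hφ (app_iff.1 h) ha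
  | capp f t₀ t₁ ih₀ ih₁ =>
    have key : ∀ {s t : NTerm A X F C}, EnvEq D (φ ∘ e) e s t → EnvEq D (φ ∘ e) e t s →
        EnvEq D (φ ∘ e) e s s := by
      intro s t h h'
      have h2 : EnvEq D (φ ∘ φ ∘ e) e s s := (h.map φ).trans h'
      have h4 := ((h2.map φ).map φ).trans h2
      have : φ ∘ φ ∘ φ ∘ φ ∘ e = φ ∘ e := by
        rw [show φ ∘ φ ∘ φ ∘ φ ∘ e = (φ ∘ φ ∘ φ) ∘ φ ∘ e from rfl, hφ]; rfl
      rwa [this] at h4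
    rcases capp_iff.1 h with ⟨h₀, h₁⟩ | ⟨h₀, h₁⟩
    · exact ha.elim (ih₀ _ _ hφ h₀) (ih₁ _ _ hφ h₁)
    · exact ha.elim (ih₀ _ _ hφ (key h₀ h₁)) (ih₁ _ _ hφ (key h₁ h₀))

/-- If two swappings of three atoms fix a term modulo commutativity, then the atom `b` that they
share is not free in it. One swapping alone does not suffice: `(a b)` fixes `f(a, b)` for a
commutative `f`. -/
theorem not_mem_free_of_swaps {a b c : A} (hab : a ≠ b) (hac : a ≠ c) (hbc : b ≠ c)
    (h₁ : EnvEq D (Equiv.swap a b) id t t) (h₂ : EnvEq D (Equiv.swap b c) id t t) :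
    b ∉ free D t := by
  intro hb
  have h : EnvEq D ((Equiv.swap a b ∘ Equiv.swap b c) ∘ id) id t t := (h₂.map _).trans h₁
  have h3 : (Equiv.swap a b ∘ Equiv.swap b c) ∘ (Equiv.swap a b ∘ Equiv.swap b c) ∘
      (Equiv.swap a b ∘ Equiv.swap b c) = id := by
    funext x
    simp only [Function.comp_apply, Equiv.swap_apply_def, id]
    grind
  have := apply_eq_of_order_three t _ _ h3 h hb
  simp [Equiv.swap_apply_of_ne_of_ne hac.symm hbc.symm] at this
  exact hbc this.symm

end EnvEq

end

section

variable {A : Type u} {X F C : Type*}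

/-! ### Derivability is equality relative to environments -/

namespace EnvEq

variable [DecidableEq A] {V : Type u} {D : X → Set A} {e₁ e₂ e₁' e₂' : A → V}
  {s t : NTerm A X F C}

theorem congr_env (h₁ : ∀ a ∈ free D s, e₁ a = e₁' a) (h₂ : ∀ a ∈ free D t, e₂ a = e₂' a) :
    EnvEq D e₁ e₂ s t ↔ EnvEq D e₁' e₂' s t :=
  ⟨fun h => ((of_agree s h₁).symm.trans h).trans (of_agree t h₂),
    fun h => ((of_agree s h₁).trans h).trans (of_agree t h₂).symm⟩

/-- A permutation fixes an abstraction iff it fixes the body with a fresh atom for the bound one. -/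
theorem abs_iff_swap {π : FinPerm A} {a c : A} (hπ : π.1 c = c) (hc : c ∉ free D t) :
    EnvEq D (extend π.1 a) (extend id a) t t ↔
      EnvEq D (π.1 ∘ Equiv.swap a c) (Equiv.swap a c) t t := by
  have : Nonempty A := ⟨a⟩
  rw [← map_iff (extend_injective Function.injective_id c)]
  apply congr_env
  · intro x hx
    have hxc : x ≠ c := fun h => hc (h ▸ hx)
    by_cases hxa : x = a
    · subst hxa; simp [hπ]
    · have : π.1 x ≠ c := fun h => hxc (π.1.injective (h.trans hπ.symm))
      simp [extend_of_ne _ hxa, Equiv.swap_apply_of_ne_of_ne hxa hxc, extend_of_ne _ this]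
  · intro x hx
    have hxc : x ≠ c := fun h => hc (h ▸ hx)
    by_cases hxa : x = a
    · subst hxa; simp
    · simp [extend_of_ne _ hxa, Equiv.swap_apply_of_ne_of_ne hxa hxc, extend_of_ne _ hxc]

theorem abs_ne_iff {a b : A} (hab : a ≠ b) :
    EnvEq D (extend id a) (extend id b) s t ↔
      EnvEq D id id s (t.act (FinPerm.swap a b)) ∧ a ∉ free D t := by
  have : Nonempty A := ⟨a⟩
  have key : a ∉ free D t →
      (EnvEq D (extend id a) (extend id b) s t ↔ EnvEq D id id s (t.act (FinPerm.swap a b))) := by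
    intro ha
    rw [act_right_iff, ← map_iff (extend_injective (Function.injective_id (α := A)) a)]
    apply congr_env (fun _ _ => rfl)
    intro x hx
    have hxa : x ≠ a := fun h => ha (h ▸ hx)
    by_cases hxb : x = b
    · subst hxb; simp [FinPerm.swap]
    · simp [FinPerm.swap, extend_of_ne _ hxa, extend_of_ne _ hxb,
        Equiv.swap_apply_of_ne_of_ne hxa hxb]
  refine ⟨fun h => ?_, fun h => (key h.2).2 h.1⟩
  have ha : a ∉ free D t := by
    intro ha
    obtain ⟨x, -, hx⟩ := h.symm.exists_free ha
    rw [extend_of_ne _ hab] at hx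
    by_cases hxa : x = a
    · subst hxa; simp at hx
    · rw [extend_of_ne _ hxa] at hx
      exact hxa (Option.some.inj hx).symm
  exact ⟨(key ha).1 h, ha⟩

/-- If the swapping of `a` with a fresh atom fixes a term, then `a` is not free in it. -/
theorem not_mem_free_of_swap {a c : A} (hc : c ∉ free D t)
    (h : EnvEq D (Equiv.swap a c) id t t) : a ∉ free D t := by
  intro ha
  obtain ⟨b, hb, hab⟩ := h.symm.exists_free ha
  have : b = c := by
    have := congrArg (Equiv.swap a c) hab
    simpa using this.symm
  exact hc (this ▸ hb)

theorem swap_of_not_mem_free {a c : A} (ha : a ∉ free D t) (hc : c ∉ free D t) :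
    EnvEq D (Equiv.swap a c) id t t :=
  of_agree t fun _ hx => Equiv.swap_apply_of_ne_of_ne (fun h => ha (h ▸ hx)) fun h => hc (h ▸ hx)

end EnvEq

/-- The atoms that are fresh for the variable `x` in a judgement with context `Υ` and newly
quantified atoms `c`. -/
def freshFor (Υ : Ctx A X) (c : Finset A) (x : X) : Set A := Υ.permSupp x ∪ c

theorem freshFor_insert [DecidableEq A] (Υ : Ctx A X) (c : Finset A) (c₁ : A) (x : X) :
    freshFor Υ (insert c₁ c) x = insert c₁ (freshFor Υ c x) := by
  ext y
  simp only [freshFor, Finset.coe_insert, Set.mem_union, Set.mem_insert_iff]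
  tauto

/-- The number of nodes of a term. -/
def NTerm.size : NTerm A X F C → ℕ
  | .atom _ => 1
  | .susp _ _ => 1
  | .abs _ t => t.size + 1
  | .tuple _ t => ∑ i, (t i).size + 1
  | .app _ t => t.size + 1
  | .capp _ t₀ t₁ => t₀.size + t₁.size + 1

theorem NTerm.size_act (π : FinPerm A) (t : NTerm A X F C) : (t.act π).size = t.size := by
  induction t <;> simp_all [NTerm.act, NTerm.size]

theorem EnvEq.size_eq [DecidableEq A] {V : Type u} {D : X → Set A} {e₁ e₂ : A → V}
    {s t : NTerm A X F C} (h : EnvEq D e₁ e₂ s t) : s.size = t.size := by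
  induction h with
  | capp_swap _ _ _ _ _ _ _ _ _ ih₀ ih₁ => simp only [NTerm.size, ih₀, ih₁]; omega
  | _ => simp_all [NTerm.size]

variable [DecidableEq A] {Υ : Ctx A X} {c : Finset A}

mutual

theorem Fixes.envEq {c : Finset A} {π : FinPerm A} {t : NTerm A X F C} :
    Fixes Υ c π t → EnvEq (freshFor Υ c) π.1 id t t
  | .atom _ _ _ h => .atom _ _ _ _ h
  | .var _ π ρ x h => by
    refine .susp _ _ _ _ _ fun a ha => ?_
    by_contra h'
    refine ha ?_
    by_cases hac : a ∈ c
    · exact .inr hac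
    · refine .inl (h a (mem_supp.2 fun h2 => h' ?_) hac)
      simpa [Equiv.symm_apply_eq] using h2
  | .app _ _ _ _ h => .app _ _ _ _ _ h.envEq
  | .tuple _ _ _ _ h => .tuple _ _ _ _ _ fun i => (h i).envEq
  | .abs _ π a t c₁ _ _ h₃ h₄ h => by
    have ih := h.envEq
    simp only [NTerm.atoms, Finset.mem_insert, not_or] at h₄
    rw [EnvEq.act_left_iff, EnvEq.act_right_iff] at ih
    have hπ : π.1 c₁ = c₁ := by simpa [mem_supp] using h₃
    rw [EnvEq.abs_iff]
    refine EnvEq.of_insert (fun x => (freshFor_insert Υ c c₁ x).subset) h₄.2 h₄.2 ?_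
      ((EnvEq.abs_iff_swap hπ ?_).2 ih)
    · rw [extend_of_ne _ h₄.1, extend_of_ne _ h₄.1, hπ]; rfl
    · exact not_mem_free _ (fun x => by simp [freshFor_insert]) t h₄.2
  | .capp _ _ _ _ _ h => (EnvEq.act_left_iff _).1 h.envEq

theorem Equal.envEq {c : Finset A} {s t : NTerm A X F C} :
    Equal Υ c s t → EnvEq (freshFor Υ c) id id s t
  | .atom _ _ => .atom _ _ _ _ rfl
  | .var _ π ρ x h => by
    refine .susp _ _ _ _ _ fun a ha => ?_
    by_contra h'
    refine ha ?_
    by_cases hac : a ∈ c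
    · exact .inr hac
    · refine .inl (h a (mem_supp.2 fun h2 => h' ?_) hac)
      simpa [Equiv.symm_apply_eq] using h2
  | .app _ _ _ _ h => .app _ _ _ _ _ h.envEq
  | .tuple _ _ _ _ h => .tuple _ _ _ _ _ fun i => (h i).envEq
  | .abs _ a s t h => .abs _ _ _ _ _ _ (h.envEq.map (extend id a))
  | .abs_ne _ a b s t c₁ hab _ _ h₃ h₄ h h' => by
    have ih := h.envEq
    have ih' := h'.envEq
    simp only [NTerm.atoms, Finset.mem_insert, not_or] at h₃ h₄
    rw [EnvEq.abs_iff, EnvEq.abs_ne_iff hab]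
    refine ⟨ih, fun ha => ?_⟩
    have hc₁ : c₁ ∉ free (freshFor Υ (insert c₁ c)) t :=
      not_mem_free _ (fun x => by simp [freshFor_insert]) t h₄.2
    exact EnvEq.not_mem_free_of_swap hc₁ ih'
      (free_subset_insert (fun x => (freshFor_insert Υ c c₁ x).subset) t h₄.2 (Ne.symm h₃.1) ha)
  | .capp _ _ _ _ _ _ h₀ h₁ => .capp _ _ _ _ _ _ _ h₀.envEq h₁.envEq
  | .capp_swap _ _ _ _ _ _ h₀ h₁ => .capp_swap _ _ _ _ _ _ _ h₀.envEq h₁.envEq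

end

variable [Infinite A]

theorem exists_not_mentions (Υ : Ctx A X) (U : Finset A) : ∃ c, ¬ Υ.Mentions c ∧ c ∉ U := by
  obtain ⟨c, hc⟩ := Infinite.exists_notMem_finset ((Υ.biUnion fun p => p.1.supp) ∪ U)
  simp only [Finset.mem_union, Finset.mem_biUnion, not_or] at hc
  exact ⟨c, hc⟩

/-- Derivability of terms of size at most `n`; both judgements are treated at once, as their rules
refer to each other. -/
theorem derivable_of_envEq (Υ : Ctx A X) (n : ℕ) :
    (∀ (c : Finset A) (s t : NTerm A X F C), s.size ≤ n →
      EnvEq (freshFor Υ c) id id s t → Equal Υ c s t) ∧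
    (∀ (c : Finset A) (π : FinPerm A) (t : NTerm A X F C), t.size ≤ n →
      EnvEq (freshFor Υ c) π.1 id t t → Fixes Υ c π t) := by
  induction n with
  | zero =>
    constructor
    · intro c s t h; cases s <;> simp [NTerm.size] at h
    · intro c π t h; cases t <;> simp [NTerm.size] at h
  | succ n ih =>
    obtain ⟨ihE, ihF⟩ := ih
    constructor
    · intro c s t hn h
      cases h with
      | atom _ _ a b h => cases h; exact .atom _ _
      | susp _ _ π ρ x h =>
        refine .var _ _ _ _ fun a ha hac => ?_
        by_contra h'
        have := h a fun h2 => h2.elim h' hac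
        exact mem_supp.1 ha (by simpa [Equiv.symm_apply_eq] using this)
      | abs _ _ a b s t h =>
        simp only [NTerm.size, Nat.add_le_add_iff_right] at hn
        by_cases hab : a = b
        · subst hab
          have : Nonempty A := ⟨a⟩
          exact .abs _ _ _ _ (ihE _ _ _ hn
            ((EnvEq.map_iff (extend_injective Function.injective_id a)).1 h))
        · have hs := h.size_eq
          rw [EnvEq.abs_ne_iff hab] at h
          obtain ⟨c₁, h₁, h₂⟩ := exists_not_mentions Υ
            (c ∪ (NTerm.abs a s).atoms ∪ (NTerm.abs b t).atoms)
          simp only [Finset.mem_union, not_or] at h₂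
          obtain ⟨⟨h₂, h₃⟩, h₄⟩ := h₂
          refine .abs_ne _ _ _ _ _ c₁ hab h₂ h₁ h₃ h₄ (ihE _ _ _ hn h.1)
            (ihF _ _ _ (hs ▸ hn) ?_)
          simp only [NTerm.atoms, Finset.mem_insert, not_or] at h₄
          have hc₁ : c₁ ∉ free (freshFor Υ (insert c₁ c)) t :=
            not_mem_free _ (fun x => by simp [freshFor_insert]) t h₄.2
          refine EnvEq.swap_of_not_mem_free (fun ha => ?_) hc₁
          have : ∀ x, freshFor Υ c x ⊆ insert c₁ (freshFor Υ (insert c₁ c) x) := fun x => by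
            rw [freshFor_insert]; exact fun y hy => .inr (.inr hy)
          refine h.2 (free_subset_insert this t h₄.2 ?_ ha)
          rintro rfl; exact hc₁ ha
      | tuple _ _ m s t h =>
        refine .tuple _ _ _ _ fun i => ihE _ _ _ ?_ (h i)
        have := Finset.single_le_sum (f := fun i => (s i).size) (fun _ _ => Nat.zero_le _)
          (Finset.mem_univ i)
        simp only [NTerm.size] at hn
        omega
      | app _ _ f s t h =>
        exact .app _ _ _ _ (ihE _ _ _ (by simpa [NTerm.size] using hn) h)
      | capp _ _ f s₀ s₁ t₀ t₁ h₀ h₁ =>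
        simp only [NTerm.size] at hn
        exact .capp _ _ _ _ _ _ (ihE _ _ _ (by omega) h₀) (ihE _ _ _ (by omega) h₁)
      | capp_swap _ _ f s₀ s₁ t₀ t₁ h₀ h₁ =>
        simp only [NTerm.size] at hn
        exact .capp_swap _ _ _ _ _ _ (ihE _ _ _ (by omega) h₀) (ihE _ _ _ (by omega) h₁)
    · intro c π t hn h
      cases t with
      | atom a => cases h with | atom _ _ _ _ h => exact .atom _ _ _ h
      | susp ρ x =>
        cases h with
        | susp _ _ _ _ _ h =>
          refine .var _ _ _ _ fun a ha hac => ?_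
          by_contra h'
          have := h a fun h2 => h2.elim h' hac
          exact mem_supp.1 ha (by simpa [Equiv.symm_apply_eq] using this)
      | abs a t =>
        simp only [NTerm.size, Nat.add_le_add_iff_right] at hn
        rw [EnvEq.abs_iff] at h
        obtain ⟨c₁, h₁, h₂⟩ := exists_not_mentions Υ (c ∪ π.supp ∪ (NTerm.abs a t).atoms)
        simp only [Finset.mem_union, not_or] at h₂
        obtain ⟨⟨h₂, h₃⟩, h₄⟩ := h₂
        refine .abs _ _ _ _ c₁ h₂ h₁ h₃ h₄ (ihF _ _ _ (by rwa [NTerm.size_act]) ?_)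
        simp only [NTerm.atoms, Finset.mem_insert, not_or] at h₄
        have hπ : π.1 c₁ = c₁ := by simpa [mem_supp] using h₃
        rw [EnvEq.act_left_iff, EnvEq.act_right_iff]
        refine (EnvEq.abs_iff_swap hπ ?_).1 (h.mono fun x => ?_)
        · exact not_mem_free _ (fun x => by simp [freshFor_insert]) t h₄.2
        · rw [freshFor_insert]; exact Set.subset_insert _ _
      | tuple m t =>
        rw [EnvEq.tuple_iff] at h
        refine .tuple _ _ _ _ fun i => ihF _ _ _ ?_ (h i)
        have := Finset.single_le_sum (f := fun i => (t i).size) (fun _ _ => Nat.zero_le _)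
          (Finset.mem_univ i)
        simp only [NTerm.size] at hn
        omega
      | app f t =>
        exact .app _ _ _ _ (ihF _ _ _ (by simpa [NTerm.size] using hn) (EnvEq.app_iff.1 h))
      | capp f t₀ t₁ =>
        simp only [NTerm.size] at hn
        refine .capp _ _ _ _ _ ?_
        have hE : ∀ s t : NTerm A X F C, s.size ≤ n → EnvEq (freshFor Υ c) π.1 id s t →
            Equal Υ c (s.act π) t := fun s t hs h =>
          ihE _ _ _ (by rwa [NTerm.size_act]) ((EnvEq.act_left_iff π).2 h)
        rcases EnvEq.capp_iff.1 h with ⟨h₀, h₁⟩ | ⟨h₀, h₁⟩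
        · exact .capp _ _ _ _ _ _ (hE _ _ (by omega) h₀) (hE _ _ (by omega) h₁)
        · exact .capp_swap _ _ _ _ _ _ (hE _ _ (by omega) h₀) (hE _ _ (by omega) h₁)

/-- The meaning of the judgement `Υ ⊢ И c. s ≈ t`. -/
theorem equal_iff {s t : NTerm A X F C} :
    Equal Υ c s t ↔ EnvEq (freshFor Υ c) id id s t :=
  ⟨Equal.envEq, (derivable_of_envEq Υ _).1 c s t le_rfl⟩

/-- The meaning of the judgement `Υ ⊢ И c. π ⋏ t`. -/
theorem fixes_iff {π : FinPerm A} {t : NTerm A X F C} :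
    Fixes Υ c π t ↔ EnvEq (freshFor Υ c) π.1 id t t :=
  ⟨Fixes.envEq, (derivable_of_envEq Υ _).2 c π t le_rfl⟩

end

section

variable {A : Type u} {X F C : Type*}

/-! ### Substitution, permutation and renaming -/

theorem mul_comm_of_fixes {τ π : FinPerm A} (h : ∀ a ∈ π.supp, τ.1 a = a) : τ * π = π * τ := by
  ext a
  simp only [Subgroup.coe_mul, Equiv.Perm.mul_apply]
  have h' : ∀ a, π.1 a ≠ a → τ.1 a = a := fun a ha => h a (mem_supp.2 ha)
  by_cases ha : π.1 a = a
  · rw [ha]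
    by_contra h2
    have h3 : π.1 (τ.1 a) ≠ τ.1 a := fun h3 => h2 h3.symm
    have := τ.1.injective (h' _ h3)
    exact h3 (by rw [this, ha])
  · rw [h' a ha, h' _ fun h2 => ha (π.1.injective h2)]

namespace NTerm

theorem act_act (π ρ : FinPerm A) (t : NTerm A X F C) : (t.act ρ).act π = t.act (π * ρ) := by
  induction t <;> simp_all [act, mul_assoc]

theorem bind_act (δ : X → NTerm A X F C) (π : FinPerm A) (t : NTerm A X F C) :
    (t.act π).bind δ = (t.bind δ).act π := by
  induction t <;> simp_all [act, bind, act_act]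

theorem bind_bind (σ δ : X → NTerm A X F C) (t : NTerm A X F C) :
    (t.bind σ).bind δ = t.bind fun x => (σ x).bind δ := by
  induction t <;> simp_all [bind, bind_act]

theorem bind_susp_one (t : NTerm A X F C) : t.bind (susp 1) = t := by
  induction t <;> simp_all [act, bind]

theorem bind_congr [DecidableEq X] {σ δ : X → NTerm A X F C} {t : NTerm A X F C}
    (h : ∀ x ∈ t.vars, σ x = δ x) : t.bind σ = t.bind δ := by
  induction t with
  | atom a => rfl
  | susp π x => simp [bind, h x (by simp [vars])]
  | abs a t ih => simp [bind, ih h]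
  | tuple n t ih =>
    simp only [bind, tuple.injEq, heq_eq_eq, true_and]
    funext i
    exact ih i fun x hx => h x (by simpa [vars] using ⟨i, hx⟩)
  | app f t ih => simp [bind, ih h]
  | capp f t₀ t₁ ih₀ ih₁ =>
    simp [bind, ih₀ fun x hx => h x (by simp [vars, hx]), ih₁ fun x hx => h x (by simp [vars, hx])]

theorem vars_act [DecidableEq X] (π : FinPerm A) (t : NTerm A X F C) :
    (t.act π).vars = t.vars := by
  induction t <;> simp_all [act, vars]

theorem bind_rename (δ : X → NTerm A X F C) (τ : FinPerm A) (t : NTerm A X F C) :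
    (t.rename τ).bind δ = (t.bind fun x => (δ x).act τ⁻¹).act τ := by
  induction t <;> simp_all [rename, act, bind, act_act, mul_assoc]

theorem rename_eq_self [DecidableEq A] {τ : FinPerm A} {t : NTerm A X F C}
    (h : ∀ a ∈ t.atoms, τ.1 a = a) : t.rename τ = t := by
  induction t with
  | atom a => simp [rename, h a (by simp [atoms])]
  | susp π x =>
    have : τ * π * τ⁻¹ = π := by
      rw [mul_inv_eq_iff_eq_mul]
      exact mul_comm_of_fixes fun a ha => h a ha
    simp [rename, this]
  | abs a t ih =>
    simp only [atoms, Finset.mem_insert, forall_eq_or_imp] at h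
    simp [rename, h.1, ih h.2]
  | tuple n t ih =>
    simp only [rename, tuple.injEq, heq_eq_eq, true_and]
    funext i
    exact ih i fun a ha => h a (by simpa [atoms] using ⟨i, ha⟩)
  | app f t ih => simp [rename, ih h]
  | capp f t₀ t₁ ih₀ ih₁ =>
    simp [rename, ih₀ fun a ha => h a (by simp [atoms, ha]),
      ih₁ fun a ha => h a (by simp [atoms, ha])]

theorem size_le_size_bind [DecidableEq X] (δ : X → NTerm A X F C) {x : X} {t : NTerm A X F C}
    (hx : x ∈ t.vars) : (δ x).size ≤ (t.bind δ).size := by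
  induction t with
  | atom a => simp [vars] at hx
  | susp π y =>
    obtain rfl : x = y := by simpa [vars] using hx
    simp [bind, size_act]
  | abs a t ih => exact (ih hx).trans (by simp [bind, size])
  | tuple n t ih =>
    simp only [vars, Finset.mem_biUnion, Finset.mem_univ, true_and] at hx
    obtain ⟨i, hi⟩ := hx
    have := Finset.single_le_sum (f := fun i => ((t i).bind δ).size) (fun _ _ => Nat.zero_le _)
      (Finset.mem_univ i)
    have := ih i hi
    simp only [bind, size]
    omega
  | app f t ih => exact (ih hx).trans (by simp [bind, size])
  | capp f t₀ t₁ ih₀ ih₁ =>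
    simp only [vars, Finset.mem_union] at hx
    simp only [bind, size]
    rcases hx with hx | hx
    · have := ih₀ hx; omega
    · have := ih₁ hx; omega

/-- The occurs check: a variable occurring properly inside a term gets a smaller instance. -/
theorem size_lt_size_bind [DecidableEq X] (δ : X → NTerm A X F C) {x : X} {t : NTerm A X F C}
    (hx : x ∈ t.vars) (ht : ∀ π y, t ≠ .susp π y) : (δ x).size < (t.bind δ).size := by
  cases t with
  | atom a => simp [vars] at hx
  | susp π y => exact absurd rfl (ht π y)
  | abs a t => exact Nat.lt_succ_of_le (size_le_size_bind δ (t := t) hx)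
  | tuple n t =>
    simp only [vars, Finset.mem_biUnion, Finset.mem_univ, true_and] at hx
    obtain ⟨i, hi⟩ := hx
    have := Finset.single_le_sum (f := fun i => ((t i).bind δ).size) (fun _ _ => Nat.zero_le _)
      (Finset.mem_univ i)
    have := size_le_size_bind δ hi
    simp only [bind, size]
    omega
  | app f t => exact Nat.lt_succ_of_le (size_le_size_bind δ (t := t) hx)
  | capp f t₀ t₁ =>
    simp only [vars, Finset.mem_union] at hx
    simp only [bind, size]
    rcases hx with hx | hx
    · have := size_le_size_bind δ hx; omega
    · have := size_le_size_bind δ hx; omega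

end NTerm

section

variable [DecidableEq A] {D D' : X → Set A}

theorem EnvEq.bind_congr [DecidableEq X] {V : Type u} {σ δ : X → NTerm A X F C} (e : A → V)
    (t : NTerm A X F C) (h : ∀ x ∈ t.vars, EnvEq D id id (σ x) (δ x)) :
    EnvEq D e e (t.bind σ) (t.bind δ) := by
  induction t generalizing V with
  | atom a => exact .refl _ _
  | susp π x =>
    simp only [NTerm.bind, act_left_iff, act_right_iff]
    exact (h x (by simp [NTerm.vars])).map (e ∘ π.1)
  | abs a t ih => exact .abs _ _ _ _ _ _ (ih _ h)
  | tuple n t ih =>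
    exact .tuple _ _ _ _ _ fun i => ih i _ fun x hx => h x (by simpa [NTerm.vars] using ⟨i, hx⟩)
  | app f t ih => exact .app _ _ _ _ _ (ih _ h)
  | capp f t₀ t₁ ih₀ ih₁ =>
    exact .capp _ _ _ _ _ _ _ (ih₀ _ fun x hx => h x (by simp [NTerm.vars, hx]))
      (ih₁ _ fun x hx => h x (by simp [NTerm.vars, hx]))

/-- A permutation that moves no atom of `t` and fixes the values of its variables fixes the
instance of `t`. -/
theorem EnvEq.perm_bind [DecidableEq X] {δ : X → NTerm A X F C} {t : NTerm A X F C}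
    {π : FinPerm A} (hπ : ∀ a ∈ t.atoms, π.1 a = a)
    (h : ∀ x ∈ t.vars, EnvEq D π.1 id (δ x) (δ x)) : EnvEq D π.1 id (t.bind δ) (t.bind δ) := by
  have h1 : (t.bind δ).act π = t.bind fun x => (δ x).act π := by
    have := NTerm.bind_rename (fun x => (δ x).act π) π t
    simp only [NTerm.rename_eq_self hπ, NTerm.act_act, inv_mul_cancel, NTerm.act_one] at this
    exact this.symm
  have h2 : EnvEq D id id ((t.bind δ).act π) (t.bind δ) := by
    rw [h1]
    exact bind_congr _ _ fun x hx => (act_left_iff (e₁ := id) π).2 (h x hx)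
  exact (act_left_iff π).1 h2

/-! ### Satisfaction of constraints -/

/-- The constraint `k` holds when each variable `x` takes the value `δ x`, for the fresh sets
`D`. -/
def Constr.Sat (D : X → Set A) (δ : X → NTerm A X F C) : Constr A X F C → Prop
  | .fix π t => EnvEq D π.1 id (t.bind δ) (t.bind δ)
  | .eq s t => EnvEq D id id (s.bind δ) (t.bind δ)

theorem Constr.Sat.mono {δ : X → NTerm A X F C} {k : Constr A X F C} (hD : ∀ x, D x ⊆ D' x)
    (h : k.Sat D δ) : k.Sat D' δ := by
  cases k <;> exact EnvEq.mono hD h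

theorem Constr.Sat.congr [DecidableEq X] {δ δ' : X → NTerm A X F C} {k : Constr A X F C}
    (hδ : ∀ x, EnvEq D id id (δ x) (δ' x)) (h : k.Sat D δ) : k.Sat D δ' := by
  have H : ∀ {V : Type u} (e : A → V) (t : NTerm A X F C), EnvEq D e e (t.bind δ) (t.bind δ') :=
    fun e t => EnvEq.bind_congr e t fun x _ => hδ x
  cases k with
  | fix π t => exact ((H _ t).symm.trans h).trans (H _ t)
  | eq s t => exact ((H _ s).symm.trans h).trans (H _ t)

theorem Constr.sat_subst {δ : X → NTerm A X F C} {k : Constr A X F C} {σ : Subst A X F C} :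
    (k.subst σ).Sat D δ ↔ k.Sat D fun x => (σ.val x).bind δ := by
  cases k <;> simp [Constr.Sat, Constr.subst, NTerm.subst, NTerm.bind_bind]

theorem Constr.sat_fix_iff {δ : X → NTerm A X F C} {π : FinPerm A} {t : NTerm A X F C} :
    (Constr.fix π t).Sat D δ ↔ (Constr.eq (t.act π) t).Sat D δ := by
  simp only [Constr.Sat, NTerm.bind_act, EnvEq.act_left_iff]
  rfl

theorem Constr.sat_conj_iff [Nonempty A] {δ : X → NTerm A X F C} {π ρ : FinPerm A} {x : X} :
    (Constr.fix (ρ⁻¹ * π) (.susp 1 x)).Sat D δ ↔ (Constr.eq (.susp π x) (.susp ρ x)).Sat D δ := by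
  simp only [Constr.Sat, NTerm.bind, NTerm.act_one, EnvEq.act_left_iff, EnvEq.act_right_iff]
  rw [← EnvEq.map_iff ρ.1.injective]
  have : ρ.1 ∘ (ρ⁻¹ * π).1 = id ∘ π.1 := by funext a; simp
  rw [this]; rfl

end

end

section

variable {A : Type u} {X F C : Type*} [DecidableEq A] {D : X → Set A}

/-! ### The simplification rules preserve and reflect satisfaction -/

/-- A permutation `π` fixes an abstraction `[a]t` if it fixes `(a c₁) · t`, where `c₁` is a new atom
that need not be fresh for `t`: it is enough that `(c₁ c₂)` fixes `t`. If `π` moves `a`, then this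
makes `c₁` fresh for `t`, as `(c₁ c₂)` and its conjugate `(π(a) c₂)` fix `t`; otherwise `π` commutes
with `(a c₁)`. -/
theorem EnvEq.abs_of_swaps {π : FinPerm A} {a c₁ c₂ : A} {t : NTerm A X F C}
    (hπ₁ : π.1 c₁ = c₁) (hπ₂ : π.1 c₂ = c₂) (h₁ : c₁ ≠ a) (h₂ : c₂ ≠ a) (hne : c₁ ≠ c₂)
    (hq : EnvEq D (Equiv.swap c₁ c₂) id t t)
    (h : EnvEq D (π.1 ∘ Equiv.swap a c₁) (Equiv.swap a c₁) t t) :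
    EnvEq D (extend π.1 a) (extend id a) t t := by
  have : Nonempty A := ⟨a⟩
  by_cases hπ : π.1 a = a
  · have hcomm : π.1 ∘ Equiv.swap a c₁ = Equiv.swap a c₁ ∘ π.1 := by
      funext x
      have := Equiv.swap_apply_apply π.1 a c₁
      rw [hπ, hπ₁] at this
      conv_rhs => rw [this]
      simp
    rw [hcomm] at h
    have h' : EnvEq D π.1 id t t := (map_iff (Equiv.swap a c₁).injective).1 h
    refine (congr_env (fun x _ => ?_) fun _ _ => rfl).1 (h'.map (extend id a))
    by_cases hx : x = a
    · subst hx; simp [hπ]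
    · have : π.1 x ≠ a := fun hxa => hx (π.1.injective (hxa.trans hπ.symm))
      simp [extend_of_ne _ hx, extend_of_ne _ this]
  · set ψ : Equiv.Perm A := Equiv.swap a c₁ * π.1 * Equiv.swap a c₁ with hψ
    have hψ₀ : EnvEq D ψ id t t :=
      (congr_env (fun _ _ => rfl) fun x _ => by simp).1 (h.map (Equiv.swap a c₁))
    have hψ₁ : ψ c₁ = π.1 a := by
      have : π.1 a ≠ c₁ := fun hc => h₁ (π.1.injective (hc.trans hπ₁.symm)).symm
      simp [hψ, Equiv.swap_apply_of_ne_of_ne hπ this]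
    have hψ₂ : ψ c₂ = c₂ := by
      simp [hψ, Equiv.swap_apply_of_ne_of_ne h₂ hne.symm, hπ₂]
    have hinv : EnvEq D (ψ⁻¹ : Equiv.Perm A) id t t :=
      (congr_env (fun _ _ => rfl) fun x _ => by simp).1 (hψ₀.map (ψ⁻¹ : Equiv.Perm A)).symm
    have hconj : EnvEq D (Equiv.swap c₂ (π.1 a)) id t t := by
      have := ((hinv.map (ψ ∘ Equiv.swap c₁ c₂)).trans (hq.map ψ)).trans hψ₀
      convert this using 1
      rw [Equiv.swap_comm, ← hψ₁]
      nth_rw 1 [← hψ₂]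
      rw [Equiv.swap_apply_apply]
      rfl
    have hc₂ : c₂ ∉ free D t := not_mem_free_of_swaps hne
      (fun hc => h₁ (π.1.injective (hπ₁.trans hc)))
      (fun hc => h₂ (π.1.injective (hπ₂.trans hc))) hq hconj
    exact (abs_iff_swap hπ₁ (not_mem_free_of_swap hc₂ hq)).2 h

variable [DecidableEq X] {δ : X → NTerm A X F C} {c₁ c₂ : A} {k : Constr A X F C}

theorem EnvEq.swap_bind {t : NTerm A X F C} (h₁ : c₁ ∉ t.atoms) (h₂ : c₂ ∉ t.atoms)
    (h : ∀ x ∈ t.vars, (Constr.fix (FinPerm.swap c₁ c₂) (.susp 1 x)).Sat D δ) :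
    EnvEq D (Equiv.swap c₁ c₂) id (t.bind δ) (t.bind δ) :=
  EnvEq.perm_bind (π := FinPerm.swap c₁ c₂)
    (fun _ ha => Equiv.swap_apply_of_ne_of_ne (fun h => h₁ (h ▸ ha)) fun h => h₂ (h ▸ ha))
    fun x hx => by simpa [Constr.Sat, NTerm.bind, NTerm.act_one] using h x hx

/-- Soundness of the simplification rules: if the constraints that replace `k` hold, then so does
`k`. -/
theorem Simp.sat {E : Problem A X F C} {N : Finset A} (h : Simp c₁ c₂ k E N) (hne : c₁ ≠ c₂)
    (h₁ : c₁ ∉ k.atoms) (h₂ : c₂ ∉ k.atoms) (hE : ∀ k' ∈ E, k'.Sat D δ) : k.Sat D δ := by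
  have : Nonempty A := ⟨c₁⟩
  cases h with
  | fix_atom π a h => exact .atom _ _ _ _ h
  | fix_app π f t => exact .app _ _ _ _ _ (hE (.fix π t) (by simp))
  | fix_capp_one π f t₀ t₁ =>
    exact Constr.sat_fix_iff.2 (.capp _ _ _ _ _ _ _ (hE (.eq (t₀.act π) t₀) (by simp))
      (hE (.eq (t₁.act π) t₁) (by simp)))
  | fix_capp_two π f t₀ t₁ =>
    exact Constr.sat_fix_iff.2 (.capp_swap _ _ _ _ _ _ _ (hE (.eq (t₀.act π) t₁) (by simp))
      (hE (.eq (t₁.act π) t₀) (by simp)))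
  | fix_tuple π n t => exact .tuple _ _ _ _ _ fun i => hE (.fix π (t i)) (by simp)
  | fix_abs π a t =>
    simp only [Finset.mem_insert, forall_eq_or_imp, Finset.forall_mem_image] at hE
    simp only [Constr.atoms, NTerm.atoms, Finset.mem_union, Finset.mem_insert, not_or, mem_supp,
      not_not] at h₁ h₂
    obtain ⟨hE, hq⟩ := hE
    simp only [Constr.Sat, NTerm.bind_act, EnvEq.act_left_iff, EnvEq.act_right_iff] at hE
    exact .abs _ _ _ _ _ _ (EnvEq.abs_of_swaps h₁.1 h₂.1 h₁.2.1 h₂.2.1 hne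
      (EnvEq.swap_bind h₁.2.2 h₂.2.2 hq) hE)
  | fix_var π ρ x hρ =>
    rw [Constr.sat_fix_iff]
    have := hE _ (Finset.mem_singleton_self _)
    rw [mul_assoc] at this
    exact Constr.sat_conj_iff.1 this
  | eq_atom a => exact .refl _ _
  | eq_app f s t => exact .app _ _ _ _ _ (hE (.eq s t) (by simp))
  | eq_capp_one f t₀ t₁ s₀ s₁ =>
    exact .capp _ _ _ _ _ _ _ (hE (.eq t₀ s₀) (by simp)) (hE (.eq t₁ s₁) (by simp))
  | eq_capp_two f t₀ t₁ s₀ s₁ =>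
    exact .capp_swap _ _ _ _ _ _ _ (hE (.eq t₀ s₁) (by simp)) (hE (.eq t₁ s₀) (by simp))
  | eq_tuple n s t =>
    exact .tuple _ _ _ _ _ fun i => hE (.eq (s i) (t i))
      (Finset.mem_image_of_mem _ (Finset.mem_univ i))
  | eq_abs a s t =>
    exact .abs _ _ _ _ _ _ (EnvEq.map (extend id a) (hE (.eq s t) (by simp)))
  | eq_abs_ne a b t s hab =>
    simp only [Finset.mem_insert, forall_eq_or_imp, Finset.forall_mem_image] at hE
    simp only [Constr.atoms, NTerm.atoms, Finset.mem_union, Finset.mem_insert, not_or] at h₁ h₂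
    obtain ⟨hE, hfix, hq⟩ := hE
    have hq' := EnvEq.swap_bind h₁.2.2 h₂.2.2 hq
    refine .abs _ _ _ _ _ _ ((EnvEq.abs_ne_iff hab).2 ⟨?_, ?_⟩)
    · simpa only [Constr.Sat, NTerm.bind_act] using hE
    · exact EnvEq.not_mem_free_of_swap
        (EnvEq.not_mem_free_of_swaps (Ne.symm h₁.1.1) (Ne.symm h₂.1.1) hne hfix hq') hfix
  | eq_var π ρ x => exact Constr.sat_conj_iff.1 (hE _ (by simp))

/-- Completeness of the rules: a constraint that holds is either solved or can be replaced, by a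
suitable rule, by constraints that hold, or by a binding that holds. The fresh sets `D N` may depend
on the set `N` of the new names that the rule uses; these have to be fresh for all values. -/
theorem Constr.Sat.exists_simp_or_inst [Nonempty A] {D : Finset A → X → Set A}
    (hD : ∀ x, D ∅ x ⊆ D {c₁, c₂} x) (h : k.Sat (D ∅) δ)
    (hk : ∀ π x, k ≠ .fix π (.susp 1 x)) (h₁ : c₁ ∉ k.atoms) (h₂ : c₂ ∉ k.atoms)
    (hf₁ : ∀ x, c₁ ∉ free (D {c₁, c₂}) (δ x)) (hf₂ : ∀ x, c₂ ∉ free (D {c₁, c₂}) (δ x)) :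
    (∃ E N, Simp c₁ c₂ k E N ∧ ∀ k' ∈ E, k'.Sat (D N) δ) ∨
      ∃ x u, Inst k x u ∧ EnvEq (D ∅) id id (δ x) (u.bind δ) := by
  have hq : ∀ x, (Constr.fix (FinPerm.swap c₁ c₂) (.susp 1 x)).Sat (D {c₁, c₂}) δ := fun x => by
    simp only [Constr.Sat, NTerm.bind, NTerm.act_one]
    exact EnvEq.swap_of_not_mem_free (hf₁ x) (hf₂ x)
  cases k with
  | fix π t =>
    left
    cases t with
    | atom a =>
      refine ⟨_, _, .fix_atom π a ?_, by simp⟩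
      cases h with | atom _ _ _ _ h => exact h
    | susp ρ x =>
      refine ⟨_, _, .fix_var π ρ x (fun hρ => hk π x (by rw [hρ])), ?_⟩
      rw [Constr.sat_fix_iff] at h
      simp only [Finset.mem_singleton, forall_eq, mul_assoc, Constr.sat_conj_iff]
      exact h
    | abs a t =>
      refine ⟨_, _, .fix_abs π a t, ?_⟩
      simp only [Finset.mem_insert, forall_eq_or_imp, Finset.forall_mem_image]
      refine ⟨?_, fun x _ => hq x⟩
      simp only [Constr.atoms, NTerm.atoms, Finset.mem_union, Finset.mem_insert, not_or, mem_supp,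
        not_not] at h₁
      simp only [Constr.Sat, NTerm.bind_act, EnvEq.act_left_iff, EnvEq.act_right_iff]
      exact (EnvEq.abs_iff_swap h₁.1 (not_mem_free_bind _ δ t h₁.2.2 fun x _ => hf₁ x)).1
        (EnvEq.abs_iff.1 (h.mono hD))
    | tuple n t =>
      refine ⟨_, _, .fix_tuple π n t, ?_⟩
      simp only [Finset.forall_mem_image]
      exact fun i _ => EnvEq.tuple_iff.1 h i
    | app f t =>
      refine ⟨_, _, .fix_app π f t, ?_⟩
      simp only [Finset.mem_singleton, forall_eq]
      exact EnvEq.app_iff.1 h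
    | capp f t₀ t₁ =>
      rw [Constr.sat_fix_iff] at h
      rcases EnvEq.capp_iff.1 h with h | h
      · refine ⟨_, _, .fix_capp_one π f t₀ t₁, ?_⟩
        simp only [Finset.mem_insert, Finset.mem_singleton, forall_eq_or_imp, forall_eq]
        exact h
      · refine ⟨_, _, .fix_capp_two π f t₀ t₁, ?_⟩
        simp only [Finset.mem_insert, Finset.mem_singleton, forall_eq_or_imp, forall_eq]
        exact h
  | eq s t =>
    -- a variable `x` on one side is eliminated, unless it occurs on the other side
    have key : ∀ (π : FinPerm A) (x : X) (t : NTerm A X F C),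
        EnvEq (D ∅) id id ((NTerm.susp π x).bind δ) (t.bind δ) →
        (x ∉ t.vars ∧ EnvEq (D ∅) id id (δ x) ((t.act π⁻¹).bind δ)) ∨ ∃ ρ, t = .susp ρ x := by
      intro π x t h
      simp only [NTerm.bind, EnvEq.act_left_iff] at h
      by_cases hx : x ∈ t.vars
      · right
        by_cases ht : ∃ ρ y, t = .susp ρ y
        · obtain ⟨ρ, y, rfl⟩ := ht
          obtain rfl : x = y := by simpa [NTerm.vars] using hx
          exact ⟨ρ, rfl⟩
        · push Not at ht
          exact absurd h.size_eq (NTerm.size_lt_size_bind δ hx ht).ne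
      · refine .inl ⟨hx, ?_⟩
        rw [NTerm.bind_act, EnvEq.act_right_iff]
        exact (EnvEq.congr_env (fun a _ => by simp) fun _ _ => rfl).1 (h.map (π⁻¹).1)
    have hsusp : ∀ π ρ x, Constr.eq s t = .eq (.susp π x) (.susp ρ x) →
        ∃ E N, Simp c₁ c₂ (.eq s t) E N ∧ ∀ k' ∈ E, k'.Sat (D N) δ := by
      intro π ρ x hst
      rw [hst] at h ⊢
      refine ⟨_, _, .eq_var π ρ x, ?_⟩
      simpa [Constr.sat_conj_iff] using h
    by_cases hs : ∃ π x, s = .susp π x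
    · obtain ⟨π, x, rfl⟩ := hs
      rcases key π x t h with ⟨hx, h'⟩ | ⟨ρ, rfl⟩
      · exact .inr ⟨x, _, .left π x t hx, h'⟩
      · exact .inl (hsusp _ _ _ rfl)
    by_cases ht : ∃ π x, t = .susp π x
    · obtain ⟨π, x, rfl⟩ := ht
      rcases key π x s h.symm with ⟨hx, h'⟩ | ⟨ρ, rfl⟩
      · exact .inr ⟨x, _, .right π x s hx, h'⟩
      · exact .inl (hsusp _ _ _ rfl)
    left
    push Not at hs ht
    cases s with
    | susp π x => exact absurd rfl (hs π x)
    | atom a =>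
      cases t with
      | susp ρ x => exact absurd rfl (ht ρ x)
      | atom b =>
        obtain rfl : a = b := by cases h with | atom _ _ _ _ h => exact h
        exact ⟨_, _, .eq_atom a, by simp⟩
      | _ => cases h
    | abs a s =>
      cases t with
      | susp ρ x => exact absurd rfl (ht ρ x)
      | abs b t =>
        by_cases hab : a = b
        · subst hab
          refine ⟨_, _, .eq_abs a s t, ?_⟩
          simp only [Finset.mem_singleton, forall_eq]
          exact (EnvEq.map_iff (extend_injective Function.injective_id a)).1 (EnvEq.abs_iff.1 h)
        · refine ⟨_, _, .eq_abs_ne a b s t hab, ?_⟩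
          simp only [Finset.mem_insert, forall_eq_or_imp, Finset.forall_mem_image]
          simp only [Constr.atoms, NTerm.atoms, Finset.mem_union, Finset.mem_insert, not_or] at h₁
          obtain ⟨h, ha⟩ := (EnvEq.abs_ne_iff hab).1 (EnvEq.abs_iff.1 (h.mono hD))
          refine ⟨?_, ?_, fun x _ => hq x⟩
          · simpa only [Constr.Sat, NTerm.bind_act] using h
          · exact EnvEq.swap_of_not_mem_free ha
              (not_mem_free_bind _ δ t h₁.2.2 fun x _ => hf₁ x)
      | _ => cases h
    | tuple n s =>
      cases t with
      | susp ρ x => exact absurd rfl (ht ρ x)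
      | tuple m t =>
        obtain rfl : n = m := by
          simp only [Constr.Sat, NTerm.bind] at h
          cases h; rfl
        refine ⟨_, _, .eq_tuple n s t, ?_⟩
        simp only [Finset.forall_mem_image]
        exact fun i _ => EnvEq.tuple_iff.1 h i
      | _ => cases h
    | app f s =>
      cases t with
      | susp ρ x => exact absurd rfl (ht ρ x)
      | app g t =>
        obtain rfl : f = g := by cases h; rfl
        refine ⟨_, _, .eq_app f s t, ?_⟩
        simp only [Finset.mem_singleton, forall_eq]
        exact EnvEq.app_iff.1 h
      | _ => cases h
    | capp f s₀ s₁ =>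
      cases t with
      | susp ρ x => exact absurd rfl (ht ρ x)
      | capp g t₀ t₁ =>
        obtain rfl : f = g := by cases h <;> rfl
        rcases EnvEq.capp_iff.1 h with h | h
        · refine ⟨_, _, .eq_capp_one f s₀ s₁ t₀ t₁, ?_⟩
          simp only [Finset.mem_insert, Finset.mem_singleton, forall_eq_or_imp, forall_eq]
          exact h
        · refine ⟨_, _, .eq_capp_two f s₀ s₁ t₀ t₁, ?_⟩
          simp only [Finset.mem_insert, Finset.mem_singleton, forall_eq_or_imp, forall_eq]
          exact h
      | _ => cases h

end

section

variable {A : Type u} {X F C : Type*}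

/-! ### Termination and finiteness of the simplification tree -/

/-- A weight of terms for which an abstraction weighs more than four times its body: solving
`[a]t ≈? [b]s` leaves an equality with `s`, a fixed-point constraint on `s`, which weighs twice as
much as `s`, and at most `weight s` constraints on variables. -/
def NTerm.weight : NTerm A X F C → ℕ
  | .atom _ => 1
  | .susp _ _ => 1
  | .abs _ t => 4 * t.weight + 1
  | .tuple _ t => ∑ i, (t i).weight + 1
  | .app _ t => t.weight + 1
  | .capp _ t₀ t₁ => t₀.weight + t₁.weight + 1

open Classical in
/-- A weight of constraints that every simplification rule decreases. -/
noncomputable def Constr.weight : Constr A X F C → ℕ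
  | .fix _ t => if ∃ x, t = .susp 1 x then 1 else 2 * t.weight
  | .eq s t => s.weight + t.weight

theorem NTerm.weight_act (π : FinPerm A) (t : NTerm A X F C) : (t.act π).weight = t.weight := by
  induction t <;> simp_all [act, weight]

theorem NTerm.weight_pos (t : NTerm A X F C) : 0 < t.weight := by
  cases t <;> simp [weight]

theorem NTerm.card_vars_le [DecidableEq X] (t : NTerm A X F C) : t.vars.card ≤ t.weight := by
  induction t with
  | atom a => simp [vars]
  | susp π x => simp [vars, weight]
  | abs a t ih => simp only [vars, weight]; omega
  | tuple n t ih =>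
    have h1 := Finset.card_biUnion_le (s := Finset.univ) (t := fun i => (t i).vars)
    have h2 := Finset.sum_le_sum (s := Finset.univ) fun i _ => ih i
    simp only [vars, weight]; omega
  | app f t ih => simp only [vars, weight]; omega
  | capp f t₀ t₁ ih₀ ih₁ =>
    have := Finset.card_union_le t₀.vars t₁.vars
    simp only [vars, weight]; omega

theorem Constr.weight_fix_le (π : FinPerm A) (t : NTerm A X F C) :
    (Constr.fix π t).weight ≤ 2 * t.weight := by
  have := t.weight_pos
  simp only [weight]
  split_ifs <;> omega

theorem sum_insert_le {ι : Type*} [DecidableEq ι] (s : Finset ι) (a : ι) (f : ι → ℕ) :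
    ∑ i ∈ insert a s, f i ≤ f a + ∑ i ∈ s, f i := by
  by_cases h : a ∈ s
  · simp [h]
  · rw [Finset.sum_insert h]

theorem sum_pair_le {ι : Type*} [DecidableEq ι] (a b : ι) (f : ι → ℕ) :
    ∑ i ∈ {a, b}, f i ≤ f a + f b := by
  simpa using sum_insert_le {b} a f

theorem sum_image_le {ι κ : Type*} [DecidableEq ι] (s : Finset κ) (g : κ → ι) (f : ι → ℕ) :
    ∑ i ∈ s.image g, f i ≤ ∑ j ∈ s, f (g j) := by
  classical
  induction s using Finset.induction_on with
  | empty => simp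
  | insert a s ha ih =>
    rw [Finset.image_insert, Finset.sum_insert ha]
    exact (sum_insert_le _ _ _).trans (by omega)

variable [DecidableEq X] {c₁ c₂ : A} {k : Constr A X F C} {E : Problem A X F C} {N : Finset A}

theorem Inst.mem_vars {x : X} {u : NTerm A X F C} (h : Inst k x u) :
    x ∈ k.vars ∧ x ∉ u.vars ∧ u.vars ⊆ k.vars := by
  cases h with
  | left π x t hx =>
    simp only [Constr.vars, NTerm.vars, NTerm.vars_act]
    exact ⟨by simp, hx, Finset.subset_union_right⟩
  | right π x t hx =>
    simp only [Constr.vars, NTerm.vars, NTerm.vars_act]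
    exact ⟨by simp, hx, Finset.subset_union_left⟩

theorem NTerm.mem_vars_bind {σ : X → NTerm A X F C} {t : NTerm A X F C} {y : X} :
    y ∈ (t.bind σ).vars ↔ ∃ x ∈ t.vars, y ∈ (σ x).vars := by
  induction t with
  | atom a => simp [bind, vars]
  | susp π x => simp [bind, vars, vars_act]
  | abs a t ih => exact ih
  | tuple n t ih =>
    simp only [bind, vars, Finset.mem_biUnion, Finset.mem_univ, true_and, ih]
    exact ⟨fun ⟨i, x, hx, hy⟩ => ⟨x, ⟨i, hx⟩, hy⟩, fun ⟨x, ⟨i, hx⟩, hy⟩ => ⟨i, x, hx, hy⟩⟩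
  | app f t ih => exact ih
  | capp f t₀ t₁ ih₀ ih₁ => simp [bind, vars, ih₀, ih₁, or_and_right, exists_or]

theorem Subst.mem_vars_single {x y z : X} {u : NTerm A X F C} :
    y ∈ ((Subst.single x u).val z).vars ↔ z = x ∧ y ∈ u.vars ∨ z ≠ x ∧ y = z := by
  by_cases h : z = x
  · subst h; simp [Subst.single]
  · simp [Subst.single, h, NTerm.vars]

theorem Constr.mem_vars_subst {σ : Subst A X F C} {y : X} :
    y ∈ (k.subst σ).vars ↔ ∃ x ∈ k.vars, y ∈ (σ.val x).vars := by
  cases k <;>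
    simp [Constr.subst, Constr.vars, NTerm.subst, NTerm.mem_vars_bind, or_and_right, exists_or]

theorem Problem.mem_vars {P : Problem A X F C} {x : X} : x ∈ P.vars ↔ ∃ k ∈ P, x ∈ k.vars := by
  simp [Problem.vars]

/-- The variables of the problem left by an instantiating rule: `x` is eliminated. -/
theorem Inst.vars_subset {x : X} {u : NTerm A X F C} (h : Inst k x u) (Q : Problem A X F C) :
    Problem.vars (Q.image (Constr.subst (Subst.single x u))) ⊆ (Problem.vars (insert k Q)).erase x
    := by
  intro y hy
  obtain ⟨k', hk', hy⟩ := Problem.mem_vars.1 hy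
  obtain ⟨k'', hk'', rfl⟩ := Finset.mem_image.1 hk'
  obtain ⟨z, hz, hy⟩ := Constr.mem_vars_subst.1 hy
  obtain ⟨-, hxu, hu⟩ := h.mem_vars
  rw [Finset.mem_erase, Problem.mem_vars]
  rcases Subst.mem_vars_single.1 hy with ⟨-, hy⟩ | ⟨hz', rfl⟩
  · exact ⟨fun h => hxu (h ▸ hy), k, Finset.mem_insert_self _ _, hu hy⟩
  · exact ⟨hz', k'', Finset.mem_insert_of_mem hk'', hz⟩

theorem finite_inst (k : Constr A X F C) : {p : X × NTerm A X F C | Inst k p.1 p.2}.Finite := by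
  have : ∀ s t : NTerm A X F C, {p : X × NTerm A X F C |
      ∃ π, s = .susp π p.1 ∧ p.2 = t.act π⁻¹}.Finite := fun s t => by
    apply Set.Subsingleton.finite
    rintro ⟨x, u⟩ ⟨π, rfl, rfl⟩ ⟨x', u'⟩ ⟨π', h, h'⟩
    cases h; cases h'; rfl
  cases k with
  | fix π t => exact Set.finite_empty.subset fun p h => by cases h
  | eq s t =>
    refine ((this s t).union (this t s)).subset ?_
    rintro ⟨x, u⟩ h
    cases h with
    | left π x t => exact .inl ⟨π, rfl, rfl⟩
    | right π x t => exact .inr ⟨π, rfl, rfl⟩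

variable [DecidableEq A]

theorem Simp.weight_lt (h : Simp c₁ c₂ k E N) : ∑ k' ∈ E, k'.weight < k.weight := by
  have hvar : ∀ (π : FinPerm A) (s : Finset X),
      ∑ k' ∈ s.image (fun x => (.fix π (.susp 1 x) : Constr A X F C)), k'.weight ≤ s.card :=
    fun π s => (sum_image_le _ _ _).trans (by simp [Constr.weight])
  cases h with
  | fix_atom π a h => simp [Constr.weight, NTerm.weight]
  | fix_app π f t =>
    have := Constr.weight_fix_le π t
    simp only [Finset.sum_singleton]
    refine this.trans_lt ?_
    simp [Constr.weight, NTerm.weight]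
  | fix_capp_one π f t₀ t₁ =>
    refine (sum_pair_le _ _ _).trans_lt ?_
    simp [Constr.weight, NTerm.weight, NTerm.weight_act]; omega
  | fix_capp_two π f t₀ t₁ =>
    refine (sum_pair_le _ _ _).trans_lt ?_
    simp [Constr.weight, NTerm.weight, NTerm.weight_act]; omega
  | fix_tuple π n t =>
    refine (sum_image_le _ _ _).trans_lt
      ((Finset.sum_le_sum fun i _ => Constr.weight_fix_le π (t i)).trans_lt ?_)
    simp [Constr.weight, NTerm.weight, ← Finset.mul_sum]
  | fix_abs π a t =>
    refine (sum_insert_le _ _ _).trans_lt ?_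
    have h1 := Constr.weight_fix_le π (t.act (FinPerm.swap a c₁))
    have h2 := hvar (FinPerm.swap c₁ c₂) t.vars
    have h3 := t.card_vars_le
    have h4 : (Constr.fix π (.abs a t)).weight = 2 * (4 * t.weight + 1) := by
      simp [Constr.weight, NTerm.weight]
    rw [NTerm.weight_act] at h1
    omega
  | fix_var π ρ x hρ => simp [Constr.weight, NTerm.weight, hρ]
  | eq_atom a => simp [Constr.weight, NTerm.weight]
  | eq_app f s t => simp [Constr.weight, NTerm.weight]; omega
  | eq_capp_one f t₀ t₁ s₀ s₁ =>
    refine (sum_pair_le _ _ _).trans_lt ?_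
    simp [Constr.weight, NTerm.weight]; omega
  | eq_capp_two f t₀ t₁ s₀ s₁ =>
    refine (sum_pair_le _ _ _).trans_lt ?_
    simp [Constr.weight, NTerm.weight]; omega
  | eq_tuple n s t =>
    refine (sum_image_le _ _ _).trans_lt ?_
    simp [Constr.weight, NTerm.weight, Finset.sum_add_distrib]; omega
  | eq_abs a s t => simp [Constr.weight, NTerm.weight]; omega
  | eq_abs_ne a b t s hab =>
    refine ((sum_insert_le _ _ _).trans
      (Nat.add_le_add_left (sum_insert_le _ _ _) _)).trans_lt ?_
    have h1 := Constr.weight_fix_le (FinPerm.swap a c₁) s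
    have h2 := hvar (FinPerm.swap c₁ c₂) s.vars
    have h3 := s.card_vars_le
    have h4 : (Constr.eq t (s.act (FinPerm.swap a b))).weight = t.weight + s.weight := by
      simp [Constr.weight, NTerm.weight_act]
    have h5 : (Constr.eq (.abs a t) (.abs b s)).weight =
        4 * t.weight + 1 + (4 * s.weight + 1) := rfl
    omega
  | eq_var π ρ x => simp [Constr.weight, NTerm.weight]

theorem Simp.vars_subset (h : Simp c₁ c₂ k E N) : ∀ k' ∈ E, k'.vars ⊆ k.vars := by
  intro k' hk' x hx
  cases h <;> simp only [Finset.mem_insert, Finset.mem_singleton, Finset.mem_image,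
    Finset.notMem_empty, Finset.mem_univ, true_and] at hk' <;>
  first
  | (subst hk'; simpa [Constr.vars, NTerm.vars, NTerm.vars_act] using hx)
  | (rcases hk' with rfl | rfl <;> simp [Constr.vars, NTerm.vars, NTerm.vars_act] at hx ⊢ <;> tauto)
  | (obtain ⟨i, rfl⟩ := hk'; simp [Constr.vars, NTerm.vars] at hx ⊢
     first
     | exact ⟨i, hx⟩
     | exact hx.imp (fun h => ⟨i, h⟩) fun h => ⟨i, h⟩)
  | (rcases hk' with rfl | ⟨y, hy, rfl⟩ <;> simp [Constr.vars, NTerm.vars, NTerm.vars_act] at hx ⊢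
     · exact hx
     · exact hx ▸ hy)
  | (rcases hk' with rfl | rfl | ⟨y, hy, rfl⟩ <;>
      simp [Constr.vars, NTerm.vars, NTerm.vars_act] at hx ⊢
     · exact hx
     · exact .inr hx
     · exact .inr (hx ▸ hy))

theorem Simp.vars_union_subset (h : Simp c₁ c₂ k E N) (Q : Problem A X F C) :
    Problem.vars (Q ∪ E) ⊆ Problem.vars (insert k Q) := by
  intro y hy
  obtain ⟨k', hk', hy⟩ := Problem.mem_vars.1 hy
  rw [Problem.mem_vars]
  rcases Finset.mem_union.1 hk' with hk' | hk'
  · exact ⟨k', Finset.mem_insert_of_mem hk', hy⟩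
  · exact ⟨k, Finset.mem_insert_self _ _, h.vars_subset k' hk' hy⟩

variable {g : NameGen A}

/-- The termination measure: the number of variables, then the total weight. -/
noncomputable def Node.measure (n : Node A X F C) : ℕ ×ₗ ℕ :=
  toLex (n.prob.vars.card, ∑ k ∈ n.prob, k.weight)

theorem Step.measure_lt {n m : Node A X F C} (h : Step g n m) : m.measure < n.measure := by
  rw [Node.measure, Node.measure, Prod.Lex.toLex_lt_toLex]
  cases h with
  | simp Q σ U k E N hk h =>
    have h1 := Finset.card_le_card (h.vars_union_subset Q)
    rcases h1.lt_or_eq with h1 | h1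
    · exact .inl h1
    · refine .inr ⟨h1, ?_⟩
      have h2 := h.weight_lt
      have h3 := Finset.sum_union_inter (s₁ := Q) (s₂ := E) (f := Constr.weight)
      simp only [Finset.sum_insert hk]
      omega
  | inst Q σ U k x u hk h =>
    refine .inl ((Finset.card_le_card (h.vars_subset Q)).trans_lt ?_)
    exact Finset.card_erase_lt_of_mem
      (Problem.mem_vars.2 ⟨k, Finset.mem_insert_self _ _, h.mem_vars.1⟩)

theorem wellFounded_step (g : NameGen A) :
    WellFounded fun m n : Node A X F C => Step g n m :=
  Subrelation.wf (h₂ := InvImage.wf Node.measure wellFounded_lt) Step.measure_lt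

theorem finite_simp (c₁ c₂ : A) (k : Constr A X F C) :
    {p : Problem A X F C × Finset A | Simp c₁ c₂ k p.1 p.2}.Finite := by
  -- only the rules for commutative symbols are nondeterministic
  by_cases hk : (∃ π f t₀ t₁, k = .fix π (.capp f t₀ t₁)) ∨
      ∃ f g t₀ t₁ s₀ s₁, k = .eq (.capp f t₀ t₁) (.capp g s₀ s₁)
  · rcases hk with ⟨π, f, t₀, t₁, rfl⟩ | ⟨f, g, t₀, t₁, s₀, s₁, rfl⟩
    · refine (Set.toFinite {(({.eq (t₀.act π) t₀, .eq (t₁.act π) t₁} : Problem A X F C), ∅),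
        ({.eq (t₀.act π) t₁, .eq (t₁.act π) t₀}, ∅)}).subset ?_
      rintro ⟨E, N⟩ h
      cases h
      exacts [.inl rfl, .inr rfl]
    · refine (Set.toFinite {(({.eq t₀ s₀, .eq t₁ s₁} : Problem A X F C), ∅),
        ({.eq t₀ s₁, .eq t₁ s₀}, ∅)}).subset ?_
      rintro ⟨E, N⟩ h
      cases h
      exacts [.inl rfl, .inr rfl]
  · apply Set.Subsingleton.finite
    rintro ⟨E, N⟩ h ⟨E', N'⟩ h'
    simp only [Set.mem_ofPred_eq] at h h'
    cases h <;> cases h' <;> first | rfl | contradiction | simp at hk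

theorem finite_step (g : NameGen A) (n : Node A X F C) : {m | Step g n m}.Finite := by
  refine Set.Finite.subset (s := ⋃ k ∈ n.prob,
    ((fun p : Problem A X F C × Finset A =>
        (⟨n.prob.erase k ∪ p.1, n.sub, n.used ∪ p.2⟩ : Node A X F C)) ''
        {p | Simp (g.gen n.used).1 (g.gen n.used).2 k p.1 p.2}) ∪
      ((fun p : X × NTerm A X F C => (⟨(n.prob.erase k).image (Constr.subst (Subst.single p.1 p.2)),
        n.sub.comp (Subst.single p.1 p.2), n.used⟩ : Node A X F C)) '' {p | Inst k p.1 p.2}))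
    (n.prob.finite_toSet.biUnion fun k _ =>
      ((finite_simp _ _ k).image _).union ((finite_inst k).image _)) ?_
  intro m h
  cases h with
  | simp Q σ U k E N hk h =>
    refine Set.mem_biUnion (Finset.mem_insert_self k Q) (.inl ⟨(E, N), h, ?_⟩)
    simp [Finset.erase_insert hk]
  | inst Q σ U k x u hk h =>
    refine Set.mem_biUnion (Finset.mem_insert_self k Q) (.inr ⟨(x, u), h, ?_⟩)
    simp [Finset.erase_insert hk]

theorem finite_reachable (g : NameGen A) (n : Node A X F C) :
    {m | Relation.ReflTransGen (Step g) n m}.Finite := by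
  apply (wellFounded_step g).induction n
  intro n ih
  refine ((Set.finite_singleton n).union ((finite_step g n).biUnion ih)).subset ?_
  intro m h
  rcases Relation.ReflTransGen.cases_head h with rfl | ⟨m', h, h'⟩
  · exact .inl rfl
  · exact .inr (Set.mem_biUnion (show m' ∈ {m | Step g n m} from h) h')

end

section

variable {A : Type u} {X F C : Type*}

/-! ### Invariants of the nodes of the simplification tree -/

theorem supp_mul_subset {π ρ : FinPerm A} {U : Finset A} (hπ : π.supp ⊆ U) (hρ : ρ.supp ⊆ U) :
    (π * ρ).supp ⊆ U := by
  intro a ha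
  by_contra h
  have h1 : π.1 a = a := by simpa [mem_supp] using fun h' => h (hπ h')
  have h2 : ρ.1 a = a := by simpa [mem_supp] using fun h' => h (hρ h')
  exact mem_supp.1 ha (by simp [h1, h2])

theorem supp_inv_subset {π : FinPerm A} {U : Finset A} (hπ : π.supp ⊆ U) : π⁻¹.supp ⊆ U := by
  intro a ha
  exact hπ (mem_supp.2 fun h => mem_supp.1 ha (inv_apply_eq h))

theorem supp_one_subset (U : Finset A) : (1 : FinPerm A).supp ⊆ U := by
  intro a ha
  exact absurd rfl (mem_supp.1 ha)

variable [DecidableEq A]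

theorem supp_swap_subset {a b : A} {U : Finset A} (ha : a ∈ U) (hb : b ∈ U) :
    (FinPerm.swap a b).supp ⊆ U := by
  intro c hc
  by_contra h
  exact mem_supp.1 hc (Equiv.swap_apply_of_ne_of_ne (fun h' => h (h' ▸ ha)) fun h' => h (h' ▸ hb))

namespace NTerm

theorem atoms_act_subset {π : FinPerm A} {t : NTerm A X F C} {U : Finset A} (hπ : π.supp ⊆ U)
    (ht : t.atoms ⊆ U) : (t.act π).atoms ⊆ U := by
  have hmem : ∀ a ∈ U, π.1 a ∈ U := fun a ha => by
    by_cases h : π.1 a = a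
    · rwa [h]
    · exact hπ (mem_supp.2 fun h' => h (π.1.injective h'))
  induction t with
  | atom a =>
    simp only [atoms, act, Finset.singleton_subset_iff] at ht ⊢
    exact hmem a ht
  | susp ρ x => exact supp_mul_subset hπ ht
  | abs a t ih =>
    simp only [atoms, act, Finset.insert_subset_iff] at ht ⊢
    exact ⟨hmem a ht.1, ih ht.2⟩
  | tuple n t ih =>
    simp only [atoms, act, Finset.biUnion_subset, Finset.mem_univ, true_implies] at ht ⊢
    exact fun i => ih i (ht i)
  | app f t ih => exact ih ht
  | capp f t₀ t₁ ih₀ ih₁ =>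
    simp only [atoms, act, Finset.union_subset_iff] at ht ⊢
    exact ⟨ih₀ ht.1, ih₁ ht.2⟩

theorem atoms_bind_subset {σ : X → NTerm A X F C} {t : NTerm A X F C} {U : Finset A}
    (ht : t.atoms ⊆ U) (hσ : ∀ x, (σ x).atoms ⊆ U) : (t.bind σ).atoms ⊆ U := by
  induction t with
  | atom a => exact ht
  | susp ρ x => exact atoms_act_subset ht (hσ x)
  | abs a t ih =>
    simp only [atoms, bind, Finset.insert_subset_iff] at ht ⊢
    exact ⟨ht.1, ih ht.2⟩
  | tuple n t ih =>
    simp only [atoms, bind, Finset.biUnion_subset, Finset.mem_univ, true_implies] at ht ⊢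
    exact fun i => ih i (ht i)
  | app f t ih => exact ih ht
  | capp f t₀ t₁ ih₀ ih₁ =>
    simp only [atoms, bind, Finset.union_subset_iff] at ht ⊢
    exact ⟨ih₀ ht.1, ih₁ ht.2⟩

end NTerm

/-- All atoms of the node, among them those of the initial set `B`, are recorded as used. -/
structure Node.Recorded (B : Finset A) (n : Node A X F C) : Prop where
  base : B ⊆ n.used
  prob : ∀ k ∈ n.prob, k.atoms ⊆ n.used
  sub : ∀ x, (n.sub.val x).atoms ⊆ n.used

theorem Node.recorded_root (P : Problem A X F C) : (Node.root P).Recorded P.atoms where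
  base := subset_rfl
  prob _ hk := Finset.subset_biUnion_of_mem Constr.atoms hk
  sub _ := supp_one_subset _

variable [DecidableEq X] {c₁ c₂ : A} {k : Constr A X F C} {g : NameGen A}

theorem Simp.atoms_subset {E : Problem A X F C} {N U : Finset A} (h : Simp c₁ c₂ k E N)
    (hk : k.atoms ⊆ U) (hN : N ⊆ U) : ∀ k' ∈ E, k'.atoms ⊆ U := by
  have hvar : c₁ ∈ U → c₂ ∈ U → ∀ x : X,
      (Constr.fix (FinPerm.swap c₁ c₂) (.susp 1 x) : Constr A X F C).atoms ⊆ U :=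
    fun h₁ h₂ x => Finset.union_subset (supp_swap_subset h₁ h₂) (supp_one_subset U)
  cases h <;>
    simp only [Constr.atoms, NTerm.atoms, Finset.union_subset_iff, Finset.insert_subset_iff,
      Finset.singleton_subset_iff, Finset.biUnion_subset, Finset.mem_univ, true_implies,
      Finset.forall_mem_image, Finset.mem_insert, Finset.mem_singleton, forall_eq_or_imp, forall_eq,
      Finset.notMem_empty, false_implies, implies_true] at hk hN ⊢
  case fix_app => exact hk
  case fix_capp_one =>
    exact ⟨⟨NTerm.atoms_act_subset hk.1 hk.2.1, hk.2.1⟩, NTerm.atoms_act_subset hk.1 hk.2.2, hk.2.2⟩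
  case fix_capp_two =>
    exact ⟨⟨NTerm.atoms_act_subset hk.1 hk.2.1, hk.2.2⟩, NTerm.atoms_act_subset hk.1 hk.2.2, hk.2.1⟩
  case fix_tuple => exact fun i => ⟨hk.1, hk.2 i⟩
  case fix_abs =>
    exact ⟨⟨hk.1, NTerm.atoms_act_subset (supp_swap_subset hk.2.1 hN.1) hk.2.2⟩,
      fun x _ => ⟨supp_swap_subset hN.1 hN.2, supp_one_subset U⟩⟩
  case fix_var =>
    exact ⟨supp_mul_subset (supp_mul_subset (supp_inv_subset hk.2) hk.1) hk.2, supp_one_subset U⟩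
  case eq_app => exact hk
  case eq_capp_one => exact ⟨⟨hk.1.1, hk.2.1⟩, hk.1.2, hk.2.2⟩
  case eq_capp_two => exact ⟨⟨hk.1.1, hk.2.2⟩, hk.1.2, hk.2.1⟩
  case eq_tuple => exact fun i => ⟨hk.1 i, hk.2 i⟩
  case eq_abs => exact ⟨hk.1.2, hk.2.2⟩
  case eq_abs_ne =>
    exact ⟨⟨hk.1.2, NTerm.atoms_act_subset (supp_swap_subset hk.1.1 hk.2.1) hk.2.2⟩,
      ⟨supp_swap_subset hk.1.1 hN.1, hk.2.2⟩,
      fun x _ => ⟨supp_swap_subset hN.1 hN.2, supp_one_subset U⟩⟩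
  case eq_var => exact ⟨supp_mul_subset (supp_inv_subset hk.2) hk.1, supp_one_subset U⟩

theorem Inst.atoms_subset {x : X} {u : NTerm A X F C} {U : Finset A} (h : Inst k x u)
    (hk : k.atoms ⊆ U) : u.atoms ⊆ U := by
  cases h <;> simp only [Constr.atoms, NTerm.atoms, Finset.union_subset_iff] at hk
  · exact NTerm.atoms_act_subset (supp_inv_subset hk.1) hk.2
  · exact NTerm.atoms_act_subset (supp_inv_subset hk.2) hk.1

theorem Subst.atoms_single_subset {x : X} {u : NTerm A X F C} {U : Finset A} (hu : u.atoms ⊆ U)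
    (y : X) : ((Subst.single x u).val y).atoms ⊆ U := by
  by_cases h : y = x
  · subst h; simpa [Subst.single] using hu
  · simpa [Subst.single, h, NTerm.atoms] using supp_one_subset U

theorem Step.recorded {B : Finset A} {n m : Node A X F C} (h : Step g n m) (hn : n.Recorded B) :
    m.Recorded B := by
  cases h with
  | simp Q σ U k E N hk h =>
    refine ⟨hn.base.trans Finset.subset_union_left, fun k' hk' => ?_,
      fun x => (hn.sub x).trans Finset.subset_union_left⟩
    rcases Finset.mem_union.1 hk' with hk' | hk'
    · exact (hn.prob k' (Finset.mem_insert_of_mem hk')).trans Finset.subset_union_left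
    · exact h.atoms_subset ((hn.prob k (Finset.mem_insert_self _ _)).trans
        Finset.subset_union_left) Finset.subset_union_right k' hk'
  | inst Q σ U k x u hk h =>
    have hu := Subst.atoms_single_subset (x := x)
      (h.atoms_subset (hn.prob k (Finset.mem_insert_self _ _)))
    refine ⟨hn.base, fun k' hk' => ?_, fun y => NTerm.atoms_bind_subset (hn.sub y) hu⟩
    obtain ⟨k'', hk'', rfl⟩ := Finset.mem_image.1 hk'
    have := hn.prob k'' (Finset.mem_insert_of_mem hk'')
    cases k'' with
    | fix π t =>
      have := Finset.union_subset_iff.1 this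
      exact Finset.union_subset this.1 (NTerm.atoms_bind_subset this.2 hu)
    | eq s t =>
      have := Finset.union_subset_iff.1 this
      exact Finset.union_subset (NTerm.atoms_bind_subset this.1 hu)
        (NTerm.atoms_bind_subset this.2 hu)

theorem Node.recorded_of_mem_tree {P : Problem A X F C} {n : Node A X F C} (h : n ∈ tree g P) :
    n.Recorded P.atoms := by
  induction h with
  | refl => exact Node.recorded_root P
  | tail _ h ih => exact h.recorded ih

/-- For some set `E` of eliminated variables, the substitution of the node moves at most the
variables in `E`, and neither its values nor the problem of the node contain these. -/
def Node.Triangular (n : Node A X F C) : Prop :=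
  ∃ E : Set X, (∀ y, y ∉ E → n.sub.val y = .susp 1 y) ∧
    (∀ y, ∀ z ∈ (n.sub.val y).vars, z ∉ E) ∧ ∀ z ∈ n.prob.vars, z ∉ E

theorem Step.triangular {n m : Node A X F C} (h : Step g n m) (hn : n.Triangular) :
    m.Triangular := by
  obtain ⟨E, h₁, h₂, h₃⟩ := hn
  cases h with
  | simp Q σ U k D N hk h => exact ⟨E, h₁, h₂, fun z hz => h₃ z (h.vars_union_subset Q hz)⟩
  | inst Q σ U k x u hk h =>
    obtain ⟨hx, hxu, hu⟩ := h.mem_vars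
    refine ⟨insert x E, fun y hy => ?_, fun y z hz => ?_, fun z hz => ?_⟩
    · rw [Set.mem_insert_iff, not_or] at hy
      change (σ.val y).bind _ = _
      rw [show σ.val y = _ from h₁ y hy.2]
      simp [NTerm.bind, NTerm.act, Subst.single, hy.1]
    · obtain ⟨w, hw, hz⟩ := NTerm.mem_vars_bind.1 hz
      rw [Set.mem_insert_iff, not_or]
      rcases Subst.mem_vars_single.1 hz with ⟨-, hz⟩ | ⟨hwx, rfl⟩
      · exact ⟨fun h => hxu (h ▸ hz),
          h₃ z (Problem.mem_vars.2 ⟨k, Finset.mem_insert_self _ _, hu hz⟩)⟩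
      · exact ⟨hwx, h₂ y z hw⟩
    · have := Finset.mem_erase.1 (h.vars_subset Q hz)
      rw [Set.mem_insert_iff, not_or]
      exact ⟨this.1, h₃ z this.2⟩

theorem Node.subst_idem_of_mem_tree {P : Problem A X F C} {n : Node A X F C} (h : n ∈ tree g P)
    (x : X) : (n.sub.val x).subst n.sub = n.sub.val x := by
  have hn : n.Triangular := by
    induction h with
    | refl => exact ⟨∅, fun _ _ => rfl, fun _ _ _ => id, fun _ _ => id⟩
    | tail _ h ih => exact h.triangular ih
  obtain ⟨E, h₁, h₂, -⟩ := hn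
  rw [NTerm.subst, NTerm.bind_congr fun z hz => h₁ z (h₂ x z hz)]
  exact NTerm.bind_susp_one _

end

section

variable {A : Type u} {X F C : Type*}

/-! ### Soundness of the computed solutions -/

theorem Problem.mem_ctx {P : Problem A X F C} {p : FinPerm A × X} :
    p ∈ P.ctx ↔ .fix p.1 (.susp 1 p.2) ∈ P := by
  simp only [Problem.ctx, Finset.mem_biUnion]
  constructor
  · rintro ⟨k, hk, hp⟩
    rcases k with ⟨π, t⟩ | ⟨s, t⟩
    · cases t <;> simp only [Constr.prim, Finset.notMem_empty] at hp
      split_ifs at hp with h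
      · subst h
        rw [Finset.mem_singleton] at hp
        subst hp
        exact hk
      · simp at hp
    · simp [Constr.prim] at hp
  · exact fun h => ⟨_, h, by simp [Constr.prim]⟩

theorem Ctx.finite_mentions (Ψ : Ctx A X) : {a | Ψ.Mentions a}.Finite :=
  (Ψ.finite_toSet.biUnion fun p _ => p.1.supp.finite_toSet).subset
    fun _ ⟨_, hp, ha⟩ => Set.mem_biUnion hp ha

variable [DecidableEq A]

theorem Subst.finite_mentions (δ : Subst A X F C) : {a | δ.Mentions a}.Finite := by
  refine (δ.fin.biUnion fun x _ => (δ.val x).atoms.finite_toSet).subset ?_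
  rintro a ⟨x, hx⟩
  refine Set.mem_biUnion (x := x) (fun h => ?_) hx
  rw [h] at hx
  exact absurd (supp_one_subset ∅ hx) (Finset.notMem_empty a)

/-- A successful problem is solved by its own context and the identity substitution. -/
theorem Problem.Successful.sat {P : Problem A X F C} (h : P.Successful) :
    ∀ k ∈ P, k.Sat (freshFor P.ctx ∅) (.susp 1) := by
  intro k hk
  obtain ⟨π, x, rfl⟩ := h k hk
  refine .susp _ _ _ _ _ fun a ha => ?_
  by_contra h'
  exact ha (.inl ⟨π, Problem.mem_ctx.2 hk, by simpa using h'⟩)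

variable [DecidableEq X] {g : NameGen A}

/-- A valuation `δ` that satisfies a node yields one that satisfies its ancestors, namely the
composition of the substitutions applied in between with `δ`. -/
theorem exists_sat_of_reachable {D : X → Set A} {δ : X → NTerm A X F C} {B : Finset A}
    {n m : Node A X F C} (h : Relation.ReflTransGen (Step g) n m) (hn : n.Recorded B)
    (hm : ∀ k ∈ m.prob, k.Sat D δ) :
    ∃ θ : X → NTerm A X F C, (∀ x, (m.sub.val x).bind δ = (n.sub.val x).bind θ) ∧
      ∀ k ∈ n.prob, k.Sat D θ := by
  induction h using Relation.ReflTransGen.head_induction_on with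
  | refl => exact ⟨δ, fun _ => rfl, hm⟩
  | head h _ ih =>
    obtain ⟨θ, hθ, hk⟩ := ih (h.recorded hn)
    cases h with
    | simp Q σ U k E N hkQ h =>
      refine ⟨θ, hθ, fun k' hk' => ?_⟩
      rcases Finset.mem_insert.1 hk' with rfl | hk'
      · have hU := hn.prob k' (Finset.mem_insert_self _ _)
        exact h.sat (g.ne U) (fun h => g.fst_new U (hU h)) (fun h => g.snd_new U (hU h))
          fun k'' hk'' => hk k'' (Finset.mem_union_right _ hk'')
      · exact hk k' (Finset.mem_union_left _ hk')
    | inst Q σ U k x u hkQ h =>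
      refine ⟨fun y => ((Subst.single x u).val y).bind θ, fun y => ?_, fun k' hk' => ?_⟩
      · rw [hθ, ← NTerm.bind_bind]; rfl
      · rcases Finset.mem_insert.1 hk' with rfl | hk'
        · have hx : ((Subst.single x u).val x) = u := by simp [Subst.single]
          -- the binding leaves unchanged the terms that do not contain `x`
          have key : ∀ t : NTerm A X F C, x ∉ t.vars →
              t.bind (fun y => ((Subst.single x u).val y).bind θ) = t.bind θ := fun t ht =>
            NTerm.bind_congr fun y hy => by
              have : y ≠ x := fun h => ht (h ▸ hy)
              simp [Subst.single, this, NTerm.bind, NTerm.act_one]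
          cases h with
          | left π x t ht =>
            simp only [Constr.Sat, key t ht, NTerm.bind, hx, NTerm.bind_act, NTerm.act_act,
              mul_inv_cancel, NTerm.act_one]
            exact .refl _ _
          | right π x t ht =>
            simp only [Constr.Sat, key t ht, NTerm.bind, hx, NTerm.bind_act, NTerm.act_act,
              mul_inv_cancel, NTerm.act_one]
            exact .refl _ _
        · exact Constr.sat_subst.1 (hk _ (Finset.mem_image_of_mem _ hk'))

theorem isSolution_of_mem_computed [Infinite A] {P : Problem A X F C} {S : NewSol A X F C}
    (hS : S ∈ computed g P) : IsSolution P S.ctx S.sub := by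
  obtain ⟨n, ⟨hn, -⟩, hsucc, rfl⟩ := hS
  obtain ⟨θ, hθ, hP⟩ := exists_sat_of_reachable hn (Node.recorded_root P) hsucc.sat
  have hθ' : θ = n.sub.val := by
    funext x
    have := hθ x
    rw [NTerm.bind_susp_one] at this
    simpa [Node.root, Subst.id, NTerm.bind, NTerm.act_one] using this.symm
  subst hθ'
  refine ⟨fun π t h => fixes_iff.2 (hP _ h), fun s t h => equal_iff.2 (hP _ h), fun x _ => ?_⟩
  rw [Node.subst_idem_of_mem_tree hn]
  exact equal_iff.2 (.refl _ _)

/-! ### Completeness of the computed solutions -/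

theorem Problem.Successful.not_step {n m : Node A X F C} (hn : n.prob.Successful) :
    ¬ Step g n m := by
  intro h
  cases h with
  | simp Q σ U k E N hk h =>
    obtain ⟨π, x, rfl⟩ := hn k (Finset.mem_insert_self _ _)
    cases h with | fix_var _ _ _ h => exact h rfl
  | inst Q σ U k x u hk h =>
    obtain ⟨π, y, rfl⟩ := hn k (Finset.mem_insert_self _ _)
    cases h

/-- The node `n` still has the solution `δ`, the fresh sets `D U` depending on the set `U` of the
names used so far. -/
structure Node.Solvable (D : Finset A → X → Set A) (δ : X → NTerm A X F C) (n : Node A X F C) :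
    Prop where
  sat : ∀ k ∈ n.prob, k.Sat (D n.used) δ
  sub : ∀ x, EnvEq (D n.used) id id ((n.sub.val x).bind δ) (δ x)

/-- A node with the solution `δ` that is not successful has a child with the solution `δ`. -/
theorem Node.Solvable.exists_step {B : Finset A} {D : Finset A → X → Set A}
    (hD : ∀ U V x, U ⊆ V → D U x ⊆ D V x) {δ : X → NTerm A X F C} {n : Node A X F C}
    (h : n.Solvable D δ) (hn : n.Recorded B) (hsucc : ¬ n.prob.Successful)
    (h₁ : ∀ x, (g.gen n.used).1 ∉ free (D (n.used ∪ {(g.gen n.used).1, (g.gen n.used).2})) (δ x))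
    (h₂ : ∀ x, (g.gen n.used).2 ∉ free (D (n.used ∪ {(g.gen n.used).1, (g.gen n.used).2})) (δ x)) :
    ∃ m, Step g n m ∧ m.Solvable D δ := by
  obtain ⟨k, hk, hkf⟩ : ∃ k ∈ n.prob, ∀ π x, k ≠ .fix π (.susp 1 x) := by
    simpa [Problem.Successful] using hsucc
  have : Nonempty A := ⟨(g.gen n.used).1⟩
  have hmono : ∀ N x, D n.used x ⊆ D (n.used ∪ N) x := fun N x =>
    hD _ _ x Finset.subset_union_left
  have hU := hn.prob k hk
  obtain ⟨Q, σ, U⟩ := n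
  obtain ⟨Q', hkQ, rfl⟩ : ∃ Q', k ∉ Q' ∧ Q = insert k Q' :=
    ⟨Q.erase k, Finset.notMem_erase _ _, (Finset.insert_erase hk).symm⟩
  rcases Constr.Sat.exists_simp_or_inst (D := fun N => D (U ∪ N)) (k := k) (δ := δ)
    (c₁ := (g.gen U).1) (c₂ := (g.gen U).2)
    (fun x => by simpa only [Finset.union_empty] using hmono _ x) (by simpa using h.sat k hk) hkf
    (fun h => g.fst_new U (hU h)) (fun h => g.snd_new U (hU h)) h₁ h₂ with
    ⟨E, N, hs, hE⟩ | ⟨x, u, hi, hu⟩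
  · refine ⟨_, .simp Q' σ U k E N hkQ hs, fun k' hk' => ?_, fun x => (h.sub x).mono (hmono N)⟩
    rcases Finset.mem_union.1 hk' with hk' | hk'
    · exact (h.sat k' (Finset.mem_insert_of_mem hk')).mono (hmono N)
    · exact hE k' hk'
  · simp only [Finset.union_empty] at hu
    have hδ : ∀ y, EnvEq (D U) id id (δ y) (((Subst.single x u).val y).bind δ) := fun y => by
      by_cases hy : y = x
      · subst hy; simpa [Subst.single] using hu
      · simpa [Subst.single, hy, NTerm.bind, NTerm.act_one] using EnvEq.refl id (δ y)
    refine ⟨_, .inst Q' σ U k x u hkQ hi, fun k' hk' => ?_, fun y => ?_⟩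
    · obtain ⟨k'', hk'', rfl⟩ := Finset.mem_image.1 hk'
      exact Constr.sat_subst.2 ((h.sat k'' (Finset.mem_insert_of_mem hk'')).congr hδ)
    · refine EnvEq.trans ?_ (h.sub y)
      change EnvEq (D U) id id (((σ.val y).bind _).bind δ) _
      rw [NTerm.bind_bind]
      exact (EnvEq.bind_congr _ _ fun z _ => hδ z).symm

/-- There is a finite permutation that fixes the atoms of `B` and moves those of `N` out of `G`. -/
theorem exists_finPerm [Infinite A] (B N G : Finset A) (h : Disjoint N B) :
    ∃ τ : FinPerm A, (∀ a ∈ B, τ.1 a = a) ∧ ∀ a ∈ N, τ.1 a ∉ G := by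
  induction N using Finset.induction_on with
  | empty => exact ⟨1, by simp, by simp⟩
  | insert a N ha ih =>
    rw [Finset.disjoint_insert_left] at h
    obtain ⟨τ, hB, hN⟩ := ih h.2
    obtain ⟨b, hb⟩ := Infinite.exists_notMem_finset (G ∪ B ∪ N.image τ.1)
    simp only [Finset.mem_union, not_or] at hb
    obtain ⟨⟨hbG, hbB⟩, hbN⟩ := hb
    refine ⟨FinPerm.swap (τ.1 a) b * τ, fun x hx => ?_, fun x hx => ?_⟩
    · have h1 : x ≠ τ.1 a := fun hxa => h.1 (by
        rw [← hB x hx] at hxa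
        exact τ.1.injective hxa ▸ hx)
      have h2 : x ≠ b := fun hxb => hbB (hxb ▸ hx)
      simp [FinPerm.swap, hB x hx, Equiv.swap_apply_of_ne_of_ne h1 h2]
    · rcases Finset.mem_insert.1 hx with rfl | hx
      · simpa [FinPerm.swap] using hbG
      · have h1 : τ.1 x ≠ τ.1 a := fun hxa => ha (τ.1.injective hxa ▸ hx)
        have h2 : τ.1 x ≠ b := fun hxb => hbN (hxb ▸ Finset.mem_image_of_mem _ hx)
        simpa [FinPerm.swap, Equiv.swap_apply_of_ne_of_ne h1 h2] using hN x hx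

/-- Every solution is an instance of a computed solution, by the solution itself. -/
theorem exists_moreGeneral [Infinite A] (g : NameGen A) {P : Problem A X F C} {Ψ : Ctx A X}
    {δ : Subst A X F C} (hδ : IsSolution P Ψ δ) : ∃ S ∈ computed g P, MoreGeneral S Ψ δ := by
  -- `τ` renames all names that are ever on offer in the tree apart from `Ψ` and `δ`
  obtain ⟨τ, hτP, hτ⟩ := exists_finPerm P.atoms
    ((finite_reachable g (Node.root P)).toFinset.biUnion (fun n =>
      n.used ∪ {(g.gen n.used).1, (g.gen n.used).2}) \ P.atoms)
    (Ψ.finite_mentions.toFinset ∪ δ.finite_mentions.toFinset) Finset.sdiff_disjoint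
  have hnew : ∀ n ∈ tree g P, ∀ a ∈ n.used ∪ {(g.gen n.used).1, (g.gen n.used).2},
      a ∉ P.atoms → ¬ Ψ.Mentions (τ.1 a) ∧ ¬ δ.Mentions (τ.1 a) := fun n hn a ha haP => by
    simpa using hτ a (Finset.mem_sdiff.2 ⟨Finset.mem_biUnion.2
      ⟨n, (finite_reachable g _).mem_toFinset.2 hn, ha⟩, haP⟩)
  clear hτ
  -- renaming the computed solution by `τ` amounts to renaming the values of `δ` by its inverse
  set δ' : X → NTerm A X F C := fun x => (δ.val x).act τ⁻¹ with hδ'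
  set D : Finset A → X → Set A := fun U => freshFor Ψ ((U \ P.atoms).image τ.1) with hD
  have hmono : ∀ U V x, U ⊆ V → D U x ⊆ D V x := fun U V x hUV =>
    Set.union_subset_union_right _ (Finset.coe_subset.2
      (Finset.image_subset_image (Finset.sdiff_subset_sdiff hUV subset_rfl)))
  have hfree : ∀ n ∈ tree g P, ∀ a ∈ ({(g.gen n.used).1, (g.gen n.used).2} : Finset A),
      ∀ x, a ∉ free (D (n.used ∪ {(g.gen n.used).1, (g.gen n.used).2})) (δ' x) := by
    intro n hn a ha x
    have haU : a ∉ n.used := by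
      rcases Finset.mem_insert.1 ha with rfl | ha
      · exact g.fst_new _
      · rw [Finset.mem_singleton.1 ha]; exact g.snd_new _
    have haP : a ∉ P.atoms := fun h => haU ((Node.recorded_of_mem_tree hn).base h)
    rw [mem_free_act, inv_inv]
    refine not_mem_free _ (fun y => .inr ?_) _ fun h =>
      (hnew n hn a (Finset.mem_union_right _ ha) haP).2 ⟨x, h⟩
    exact Finset.mem_coe.2 (Finset.mem_image_of_mem _
      (Finset.mem_sdiff.2 ⟨Finset.mem_union_right _ ha, haP⟩))
  have hbind : ∀ t : NTerm A X F C, t.atoms ⊆ P.atoms → t.bind δ.val = (t.bind δ').act τ := by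
    intro t ht
    rw [hδ', ← NTerm.bind_rename, NTerm.rename_eq_self fun a ha => hτP a (ht ha)]
  have hroot : (Node.root P).Solvable D δ' := by
    refine ⟨fun k hk => ?_, fun x => ?_⟩
    · have hkP : k.atoms ⊆ P.atoms := Finset.subset_biUnion_of_mem Constr.atoms hk
      have hsub : ∀ x, freshFor Ψ ∅ x ⊆ D P.atoms x := fun x => by simp [hD]
      refine Constr.Sat.mono hsub ?_
      cases k with
      | fix π t =>
        obtain ⟨hπ, ht⟩ := Finset.union_subset_iff.1 hkP
        have := fixes_iff.1 (hδ.fix π t hk)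
        rw [NTerm.subst, hbind t ht, EnvEq.act_left_iff, EnvEq.act_right_iff] at this
        refine (EnvEq.map_iff τ.1.injective).1
          ((EnvEq.congr_env (fun a _ => ?_) fun _ _ => rfl).1 this)
        have hcomm := mul_comm_of_fixes fun a ha => hτP a (hπ ha)
        exact (congrArg (fun π : FinPerm A => π.1 a) hcomm).symm
      | eq s t =>
        obtain ⟨hs, ht⟩ := Finset.union_subset_iff.1 hkP
        have := equal_iff.1 (hδ.eq s t hk)
        rw [NTerm.subst, NTerm.subst, hbind t ht, hbind s hs, EnvEq.act_left_iff,
          EnvEq.act_right_iff] at this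
        exact (EnvEq.map_iff τ.1.injective).1 this
    · simpa [Node.root, Subst.id, NTerm.bind, NTerm.act_one] using EnvEq.refl id (δ' x)
  have hleaf : ∀ n : Node A X F C, n ∈ tree g P → n.Solvable D δ' →
      ∃ m ∈ tree g P, m.Solvable D δ' ∧ m.prob.Successful := by
    intro n
    apply (wellFounded_step g).induction n
    intro n ih hn hs
    by_cases hsucc : n.prob.Successful
    · exact ⟨n, hn, hs, hsucc⟩
    · obtain ⟨m, hm, hms⟩ := hs.exists_step (g := g) hmono (Node.recorded_of_mem_tree hn) hsucc
        (hfree n hn _ (by simp)) (hfree n hn _ (by simp))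
      exact ih m hm (hn.tail hm) hms
  obtain ⟨n, hn, hs, hsucc⟩ := hleaf _ .refl hroot
  have hrec := Node.recorded_of_mem_tree hn
  refine ⟨_, ⟨n, ⟨hn, fun m => hsucc.not_step⟩, hsucc, rfl⟩, τ, δ, fun a ha haN => ?_,
    fun a ha => ?_, fun x => equal_iff.2 ?_, fun p hp => fixes_iff.2 ?_⟩
  · have haU : a ∈ n.used := by
      rcases ha with ⟨p, hp, ha⟩ | ⟨x, ha⟩
      · exact hrec.prob _ (Problem.mem_ctx.1 hp) (Finset.mem_union_left _ ha)
      · exact hrec.sub x ha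
    exact hτP a (by simpa [haU] using haN)
  · have ha := Finset.mem_sdiff.1 ha
    obtain ⟨h₁, h₂⟩ := hnew n hn a (Finset.mem_union_left _ ha.1) ha.2
    exact ⟨h₁, h₂, h₂⟩
  · have := (hs.sub x).map τ.1
    rw [hδ', EnvEq.act_right_iff] at this
    rw [NTerm.subst, NTerm.bind_rename, EnvEq.act_left_iff]
    exact (EnvEq.congr_env (fun _ _ => rfl) fun a _ => by simp).1 this
  · have := EnvEq.map τ.1 (hs.sat _ (Problem.mem_ctx.1 hp))
    simp only [NTerm.bind, NTerm.act_one, hδ', EnvEq.act_left_iff, EnvEq.act_right_iff] at this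
    exact (EnvEq.congr_env (fun a _ => by simp) fun a _ => by simp).1 this

theorem finite_computed (g : NameGen A) (P : Problem A X F C) : (computed g P).Finite := by
  refine ((finite_reachable g (Node.root P)).image fun n =>
    (⟨n.used \ P.atoms, n.prob.ctx, n.sub⟩ : NewSol A X F C)).subset ?_
  rintro S ⟨n, hn, -, rfl⟩
  exact ⟨n, hn.1, rfl⟩

theorem isComplete_computed [Infinite A] (g : NameGen A) (P : Problem A X F C) :
    IsComplete P (computed g P) := by
  refine ⟨fun S hS => ⟨isSolution_of_mem_computed hS, ?_⟩, fun Ψ δ hδ => exists_moreGeneral g hδ⟩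
  obtain ⟨n, -, -, rfl⟩ := hS
  exact Finset.sdiff_disjoint

theorem nonempty_nameGen (A : Type*) [DecidableEq A] [Infinite A] : Nonempty (NameGen A) := by
  choose f hf using fun U : Finset A => Infinite.exists_notMem_finset U
  refine ⟨⟨fun U => (f U, f (insert (f U) U)), hf, fun U h => ?_, fun U h => ?_⟩⟩
  · exact hf _ (Finset.mem_insert_of_mem h)
  · have h : f U = f (insert (f U) U) := h
    exact hf (insert (f U) U) (h ▸ Finset.mem_insert_self _ _)

end

end NomC

theorem mainTheorem7 {A X F C : Type*} [DecidableEq A] [Infinite A] [DecidableEq X]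
    (P : NomC.Problem A X F C) :
    (∀ g : NomC.NameGen A,
      -- the simplification tree is finite
      ((¬ ∃ n : ℕ → NomC.Node A X F C,
          n 0 = NomC.Node.root P ∧ ∀ i, NomC.Step g (n i) (n (i + 1))) ∧
        (NomC.tree g P).Finite) ∧
      -- soundness
      (∀ S ∈ NomC.computed g P, NomC.IsSolution P S.ctx S.sub) ∧
      -- completeness, by a finite set
      NomC.IsComplete P (NomC.computed g P) ∧ (NomC.computed g P).Finite) ∧
    -- C-unification is finitary
    ∃ Cs : Set (NomC.NewSol A X F C), Cs.Finite ∧ NomC.IsComplete P Cs := by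
  refine ⟨fun g => ⟨⟨?_, NomC.finite_reachable g _⟩, fun S => NomC.isSolution_of_mem_computed,
    NomC.isComplete_computed g P, NomC.finite_computed g P⟩, ?_⟩
  · rintro ⟨n, -, hn⟩
    exact (wellFounded_iff_isEmpty_descending_chain.1 (NomC.wellFounded_step g)).elim ⟨n, hn⟩
  · obtain ⟨g⟩ := NomC.nonempty_nameGen A
    exact ⟨_, NomC.finite_computed g P, NomC.isComplete_computed g P⟩
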